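/- **Hardy inequality near the boundary, noncritical case.** Let $1<p<\infty$, $\alpha<1-\frac1p$, $R\in\mathbf R$, and put $\Lambda_{\alpha,p}=\left|1-\frac1p-\alpha\right|^p$. There are positive numbers $C_2=C_2(\alpha,p,R,\eta)$ and $L=L(\alpha,p,R,\eta)$ $(\eta>0)$, depending on nothing else, with the following property. Let $N\ge 1$ and let $\Omega\subset\mathbf R^N$ be a bounded domain of class $C^2$. Write $\delta(x)=\operatorname{dist}(x,\partial\Omega)$, $A_1(t)=\log\frac Rt$, and for $\eta>0$ $$\Omega_\eta=\{x\in\Omega:\delta(x)<\eta\},\qquad \Sigma_\eta=\{x\in\Omega:\delta(x)=\eta\}.$$ Let $W^{1,p}_{\alpha,0}(\Omega)$ be the completion of $C_c^\infty(\Omega)$ with respect to the norm $$\|u\|=\Big(\int_\Omega|\nabla u|^p\,\delta^{\alpha p}\,dx\Big)^{1/p}+\Big(\int_\Omega|u|^p\,\delta^{\alpha p}\,dx\Big)^{1/p}.$$ Assume that $R>e\cdot\sup_{x\in\Omega}\delta(x)$. Then there is an $\eta_0>0$ such that for every $\eta\in(0,\eta_0)$ and every $u\in W^{1,p}_{\alpha,0}(\Omega)$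 $$\int_{\Omega_\eta}\left(|\nabla u|^p-\Lambda_{\alpha,p}\left|\frac u\delta\right|^p\right)\delta^{\alpha p}\,dx\;\ge\; C_2\int_{\Omega_\eta}\left|\frac u\delta\right|^p\frac{\delta^{\alpha p}}{A_1(\delta)^2}\,dx+L\int_{\Sigma_\eta}|u|^p\,\delta^{\alpha p}\,d\sigma_\eta .$$ Here $\sigma_\eta$ is the surface measure ($(N-1)$-dimensional Hausdorff measure) on $\Sigma_\eta$, and the values of $u$ on $\Sigma_\eta$ are those of its trace, i.e. of the continuous extension to $W^{1,p}_{\alpha,0}(\Omega)$ of the restriction map $C_c^\infty(\Omega)\to L^p(\Sigma_\eta)$, $\varphi\mapsto\varphi|_{\Sigma_\eta}$. The existence of this trace and the finiteness of all the integrals $\int_{\Omega_\eta}|\nabla u|^p\delta^{\alpha p}$, $\int_{\Omega_\eta}|u/\delta|^p\delta^{\alpha p}$, $\int_{\Omega_\eta}|u/\delta|^p\delta^{\alpha p}A_1(\delta)^{-2}$, $\int_{\Sigma_\eta}|u|^p\delta^{\alpha p}$ are part of the assertion. -/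

import Mathlib

open MeasureTheory Filter Topology
open scoped ENNReal ContDiff

namespace HardyBoundary

/-- The distance `δ(x) = dist(x, ∂Ω)` to the boundary. -/
noncomputable def bdist {N : ℕ} (Ω : Set (EuclideanSpace ℝ (Fin N)))
    (x : EuclideanSpace ℝ (Fin N)) : ℝ :=
  Metric.infDist x (frontier Ω)

/-- `Ω` is a bounded domain (nonempty, open, connected) of class `C²`: near every boundary
point, `Ω` is the set where a `C²` function with nonvanishing differential is negative.
(By the implicit function theorem: near every boundary point, up to a rigid motion, `Ω` is the
region on one side of the graph of a `C²` function.) -/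
structure IsBoundedC2Domain {N : ℕ} (Ω : Set (EuclideanSpace ℝ (Fin N))) : Prop where
  isOpen : IsOpen Ω
  isConnected : IsConnected Ω
  isBounded : Bornology.IsBounded Ω
  exists_defining : ∀ x₀ ∈ frontier Ω,
    ∃ (U : Set (EuclideanSpace ℝ (Fin N))) (ρ : EuclideanSpace ℝ (Fin N) → ℝ),
      IsOpen U ∧ x₀ ∈ U ∧ ContDiffOn ℝ 2 ρ U ∧ (∀ x ∈ U, fderiv ℝ ρ x ≠ 0) ∧
      ∀ x ∈ U, (x ∈ Ω ↔ ρ x < 0)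

/-- The tubular neighbourhood `Ω_η = {x ∈ Ω : δ(x) < η}`. -/
def tube {N : ℕ} (Ω : Set (EuclideanSpace ℝ (Fin N))) (η : ℝ) :
    Set (EuclideanSpace ℝ (Fin N)) :=
  {x | x ∈ Ω ∧ bdist Ω x < η}

/-- The level set `Σ_η = {x ∈ Ω : δ(x) = η}`. -/
def level {N : ℕ} (Ω : Set (EuclideanSpace ℝ (Fin N))) (η : ℝ) :
    Set (EuclideanSpace ℝ (Fin N)) :=
  {x | x ∈ Ω ∧ bdist Ω x = η}

/-- Surface measure on `Σ_η`: the `(N-1)`-dimensional Hausdorff measure (normalized so that it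
is Lebesgue measure on `ℝ^{N-1}`; counting measure for `N = 1`), restricted to `Σ_η`. -/
noncomputable def surfaceMeasure {N : ℕ} (Ω : Set (EuclideanSpace ℝ (Fin N))) (η : ℝ) :
    Measure (EuclideanSpace ℝ (Fin N)) :=
  (Measure.euclideanHausdorffMeasure (N - 1)).restrict (level Ω η)

/-- The constant `Λ_{α,p}`. -/
noncomputable def hardyConst (α p : ℝ) : ℝ :=
  if α = 1 - 1 / p then (1 - 1 / p) ^ p else |1 - 1 / p - α| ^ p

/-- `A₁(t) = log (R / t)`. -/
noncomputable def A₁ (R t : ℝ) : ℝ := Real.log (R / t)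

/-- The norm of `L^p(Ω, δ^{αp})`, as an extended nonnegative real, for scalar functions and for
vector fields. -/
noncomputable def weightedNorm {N : ℕ} {F : Type*} [NormedAddCommGroup F]
    (Ω : Set (EuclideanSpace ℝ (Fin N))) (α p : ℝ) (v : EuclideanSpace ℝ (Fin N) → F) : ℝ≥0∞ :=
  (∫⁻ x in Ω, ‖v x‖ₑ ^ p * ENNReal.ofReal (bdist Ω x ^ (α * p))) ^ (1 / p)

/-- `φ ∈ C_c^∞(Ω)`. -/
structure IsTestFunction {N : ℕ} (Ω : Set (EuclideanSpace ℝ (Fin N)))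
    (φ : EuclideanSpace ℝ (Fin N) → ℝ) : Prop where
  contDiff : ContDiff ℝ ∞ φ
  hasCompactSupport : HasCompactSupport φ
  tsupport_subset : tsupport φ ⊆ Ω

/-- The sequence `φ k` in `C_c^∞(Ω)` converges to `u`, with gradients converging to `G`, in the
norm `‖|∇ · |‖_{L^p(Ω, δ^{αp})} + ‖ · ‖_{L^p(Ω, δ^{αp})}`. -/
structure Approximates {N : ℕ} (Ω : Set (EuclideanSpace ℝ (Fin N))) (α p : ℝ)
    (φ : ℕ → EuclideanSpace ℝ (Fin N) → ℝ)
    (u : EuclideanSpace ℝ (Fin N) → ℝ)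
    (G : EuclideanSpace ℝ (Fin N) → EuclideanSpace ℝ (Fin N)) : Prop where
  isTestFunction : ∀ k, IsTestFunction Ω (φ k)
  tendsto : Tendsto
    (fun k => weightedNorm Ω α p (fun x => gradient (φ k) x - G x)
      + weightedNorm Ω α p (fun x => φ k x - u x)) atTop (𝓝 0)

/-- `u ∈ W^{1,p}_{α,0}(Ω)` with gradient `∇u = G`. The space is the completion of `C_c^∞(Ω)` in
the norm `‖|∇ · |‖_{L^p(Ω, δ^{αp})} + ‖ · ‖_{L^p(Ω, δ^{αp})}`, realized as the closure of
`{(φ, ∇φ) : φ ∈ C_c^∞(Ω)}` in the product of the two complete weighted spaces. As the weight is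
bounded above and below by positive constants on compact subsets of `Ω`, convergence implies
convergence in `L^p_loc(Ω)`, so that `G` is the weak gradient of `u` and is determined by `u` up
to null sets. -/
structure MemW₀ {N : ℕ} (Ω : Set (EuclideanSpace ℝ (Fin N))) (α p : ℝ)
    (u : EuclideanSpace ℝ (Fin N) → ℝ)
    (G : EuclideanSpace ℝ (Fin N) → EuclideanSpace ℝ (Fin N)) : Prop where
  aestronglyMeasurable : AEStronglyMeasurable u (volume.restrict Ω)
  aestronglyMeasurable_grad : AEStronglyMeasurable G (volume.restrict Ω)
  exists_approx : ∃ φ : ℕ → EuclideanSpace ℝ (Fin N) → ℝ, Approximates Ω α p φ u G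

/-- `g` is the trace on `Σ_η` of the element `u` of `W^{1,p}_{α,0}(Ω)` (with `∇u = G`): the value
at `u` of the continuous extension of the restriction map `C_c^∞(Ω) → L^p(Σ_η)`, `φ ↦ φ|_{Σ_η}`.
That is, the restrictions of every approximating sequence of test functions converge to `g` in
`L^p(Σ_η)`. For `u` in the space, this determines `g` up to surface-null sets. -/
structure IsTrace {N : ℕ} (Ω : Set (EuclideanSpace ℝ (Fin N))) (α p η : ℝ)
    (u : EuclideanSpace ℝ (Fin N) → ℝ)
    (G : EuclideanSpace ℝ (Fin N) → EuclideanSpace ℝ (Fin N))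
    (g : EuclideanSpace ℝ (Fin N) → ℝ) : Prop where
  aestronglyMeasurable : AEStronglyMeasurable g (surfaceMeasure Ω η)
  tendsto : ∀ φ : ℕ → EuclideanSpace ℝ (Fin N) → ℝ, Approximates Ω α p φ u G →
    Tendsto (fun k => ∫⁻ x, ‖φ k x - g x‖ₑ ^ p ∂(surfaceMeasure Ω η)) atTop (𝓝 0)

end HardyBoundary

/-!
# The Hardy inequality near the boundary, noncritical case

Put `β = 1 - 1/p - α > 0`. For a positive function `q` of the distance `δ`, Young's inequality
`|∇u|^p ≥ p |∇u| (q|u|/δ)^(p-1) - (p-1) (q|u|/δ)^p` reduces the claim to an integration by parts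
of `∇(|u|^p)` against the vector field `h(δ) ∇δ`, where `h(t) = q(t)^(p-1) t^(-pβ)`. With `q = β`
the resulting coefficient of `|u/δ|^p δ^(αp)` is the Hardy constant `β^p`, up to the curvature
term `h(δ) Δδ`. With `q = β (1 - c / log (R/t))` and `c` small, the derivative of `q` produces an
additional multiple of `log (R/t)^(-2)`, which beats both the quadratic loss from moving `q` away
from `β` and, for small `δ`, the curvature term (`exists_profile_supersolution`). The boundary
term on `Σ_η` has a good sign, because the outward normal of the tube there is `∇δ` and `h(η) >
0`.

No regularity of `δ` beyond the upper bound `Δδ ≤ N / r` is needed. A bounded `C²` domain has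
exterior balls of a uniform radius `r` (`exists_hasExteriorBalls`), so that `δ` is an infimum of
functions `|x - z| - r` with `|x - z| ≥ r` and hence semiconcave (`bdist_second_difference_le`).
Second difference quotients, Rademacher's theorem and the eikonal equation `|∇δ| = 1` turn this
into the integration by parts (`neg_integral_mul_deriv_le_integral_norm_fderiv_mul`).

The surface integral is reached without a divergence theorem. A cutoff that drops from `1` to `0`
in a layer of thickness `ε` below `Σ_η` yields averages of `|u|^p` over the layer, and a Vitali
covering shows that their lower limit dominates a multiple of the Hausdorff measure integral
(`lintegral_surfaceMeasure_le_liminf`). The multiple depends on `N`. As the trace term arises with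
a factor `η^(1-p)`, the coefficient `L(η) = η^(2-p)` is free of `N`, the spare power of `η`
absorbing the dimensional constant for small `η`.

For elements of the completion, the inequality applied to differences of test functions makes
their restrictions to `Σ_η` a Cauchy sequence in `L^p(Σ_η)`, which gives the trace. The inequality
itself passes to the limit by Fatou's lemma on the left and norm convergence on the right
(`exists_isTrace_and_lintegral_le`).
-/

namespace HardyBoundary

/-! ### The distance function of a domain with exterior balls -/

section Distance

variable {N : ℕ} {Ω : Set (EuclideanSpace ℝ (Fin N))}

lemma lipschitzWith_bdist (Ω : Set (EuclideanSpace ℝ (Fin N))) : LipschitzWith 1 (bdist Ω) :=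
  Metric.lipschitz_infDist_pt _

lemma continuous_bdist (Ω : Set (EuclideanSpace ℝ (Fin N))) : Continuous (bdist Ω) :=
  (lipschitzWith_bdist Ω).continuous

lemma bdist_nonneg (x : EuclideanSpace ℝ (Fin N)) : 0 ≤ bdist Ω x := Metric.infDist_nonneg

lemma abs_bdist_sub_le (x y : EuclideanSpace ℝ (Fin N)) :
    |bdist Ω x - bdist Ω y| ≤ ‖x - y‖ := by
  have := (lipschitzWith_bdist Ω).dist_le_mul x y
  simpa [Real.dist_eq, dist_eq_norm] using this

lemma exists_mem_frontier_of_segment {E : Type*} [NormedAddCommGroup E] [NormedSpace ℝ E]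
    {s : Set E} {x y : E} (hx : x ∈ s) (hy : y ∉ s) : ∃ w ∈ segment ℝ x y, w ∈ frontier s := by
  by_contra! h
  have hcov : segment ℝ x y ⊆ interior s ∪ interior sᶜ := by
    intro w hw
    by_contra hn
    rw [interior_compl, Set.mem_union, not_or, Set.mem_compl_iff, not_not] at hn
    exact h w hw ⟨hn.2, hn.1⟩
  have hxi : x ∈ interior s := (hcov (left_mem_segment ℝ x y)).resolve_right
    fun h' => interior_subset h' hx
  have hyi : y ∈ interior sᶜ := (hcov (right_mem_segment ℝ x y)).resolve_left
    fun h' => hy (interior_subset h')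
  obtain ⟨w, -, hw1, hw2⟩ := (convex_segment (𝕜 := ℝ) x y).isPreconnected _ _ isOpen_interior
    isOpen_interior hcov ⟨x, left_mem_segment ℝ x y, hxi⟩ ⟨y, right_mem_segment ℝ x y, hyi⟩
  exact interior_subset hw2 (interior_subset hw1)

lemma frontier_nonempty (hN : 1 ≤ N) (hΩ : IsBoundedC2Domain Ω) : (frontier Ω).Nonempty := by
  have : Nonempty (Fin N) := ⟨⟨0, hN⟩⟩
  obtain ⟨x, hx⟩ := hΩ.isConnected.nonempty
  obtain ⟨y, hy⟩ : ∃ y, y ∉ Ω := by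
    by_contra! h
    have : Ω = Set.univ := Set.eq_univ_of_forall h
    exact NormedSpace.unbounded_univ ℝ (EuclideanSpace ℝ (Fin N)) (this ▸ hΩ.isBounded)
  obtain ⟨w, -, hw⟩ := exists_mem_frontier_of_segment hx hy
  exact ⟨w, hw⟩

lemma bdist_pos (hΩ : IsOpen Ω) (hne : (frontier Ω).Nonempty) {x : EuclideanSpace ℝ (Fin N)}
    (hx : x ∈ Ω) : 0 < bdist Ω x :=
  (isClosed_frontier.notMem_iff_infDist_pos hne).1
    fun h => (hΩ.frontier_eq ▸ h).2 hx

lemma exists_mem_frontier_norm_sub_eq_bdist (hne : (frontier Ω).Nonempty)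
    (x : EuclideanSpace ℝ (Fin N)) : ∃ y ∈ frontier Ω, ‖y - x‖ = bdist Ω x := by
  obtain ⟨y, hy, h⟩ := isClosed_frontier.exists_infDist_eq_dist hne x
  exact ⟨y, hy, by rw [bdist, h, dist_comm, dist_eq_norm]⟩

lemma bdist_le_norm_sub {x y : EuclideanSpace ℝ (Fin N)} (hy : y ∈ frontier Ω) :
    bdist Ω x ≤ ‖x - y‖ := by
  rw [← dist_eq_norm]; exact Metric.infDist_le_dist_of_mem hy

/-- Along a segment from a point to a nearest boundary point, `δ` decreases at unit speed. -/
lemma bdist_add_smul_of_norm_eq {x y : EuclideanSpace ℝ (Fin N)} (hy : y ∈ frontier Ω)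
    (hxy : ‖y - x‖ = bdist Ω x) {s : ℝ} (hs : 0 ≤ s) (hs1 : s ≤ 1) :
    bdist Ω (x + s • (y - x)) = (1 - s) * bdist Ω x := by
  apply le_antisymm
  · refine (bdist_le_norm_sub hy).trans (le_of_eq ?_)
    rw [show x + s • (y - x) - y = (s - 1) • (y - x) by module, norm_smul, hxy, Real.norm_eq_abs,
      abs_sub_comm, abs_of_nonneg (by linarith)]
  · have h := abs_bdist_sub_le (Ω := Ω) x (x + s • (y - x))
    rw [show x - (x + s • (y - x)) = -(s • (y - x)) by abel, norm_neg, norm_smul, hxy,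
      Real.norm_eq_abs, abs_of_nonneg hs] at h
    linarith [(abs_le.1 h).2]

lemma exists_norm_sub_eq_bdist_eq_sub (hne : (frontier Ω).Nonempty)
    {x : EuclideanSpace ℝ (Fin N)} {ε : ℝ} (hε : 0 ≤ ε) (hx : ε ≤ bdist Ω x)
    (hpos : 0 < bdist Ω x) :
    ∃ x', ‖x' - x‖ = ε ∧ bdist Ω x' = bdist Ω x - ε := by
  obtain ⟨y, hy, hxy⟩ := exists_mem_frontier_norm_sub_eq_bdist hne x
  refine ⟨x + (ε / bdist Ω x) • (y - x), ?_, ?_⟩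
  · rw [add_sub_cancel_left, norm_smul, hxy, Real.norm_eq_abs, abs_of_nonneg (by positivity)]
    field_simp
  · rw [bdist_add_smul_of_norm_eq hy hxy (by positivity) ((div_le_one hpos).2 hx)]
    field_simp

/-- The eikonal equation `|∇δ| = 1`. -/
lemma norm_fderiv_bdist (hΩ : IsOpen Ω) (hne : (frontier Ω).Nonempty)
    {x : EuclideanSpace ℝ (Fin N)} (hx : x ∈ Ω) (hd : DifferentiableAt ℝ (bdist Ω) x) :
    ‖fderiv ℝ (bdist Ω) x‖ = 1 := by
  apply le_antisymm
  · simpa using norm_fderiv_le_of_lipschitz ℝ (lipschitzWith_bdist Ω) (x₀ := x)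
  · have hpos := bdist_pos hΩ hne hx
    obtain ⟨y, hy, hxy⟩ := exists_mem_frontier_norm_sub_eq_bdist hne x
    have h1 : HasDerivAt (fun s : ℝ => bdist Ω (x + s • (y - x)))
        (fderiv ℝ (bdist Ω) x (y - x)) 0 := by
      have h2 : HasDerivAt (fun s : ℝ => x + s • (y - x)) (y - x) 0 := by
        simpa using ((hasDerivAt_id (0 : ℝ)).smul_const (y - x)).const_add x
      have h3 : HasFDerivAt (bdist Ω) (fderiv ℝ (bdist Ω) x) (x + (0 : ℝ) • (y - x)) := by
        simpa using hd.hasFDerivAt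
      exact h3.comp_hasDerivAt 0 h2
    have h4 : HasDerivWithinAt (fun s : ℝ => bdist Ω (x + s • (y - x)))
        (-bdist Ω x) (Set.Icc 0 1) 0 := by
      have h5 : HasDerivAt (fun s : ℝ => (1 - s) * bdist Ω x) (-bdist Ω x) 0 := by
        simpa using ((hasDerivAt_id (0 : ℝ)).const_sub 1).mul_const (bdist Ω x)
      refine h5.hasDerivWithinAt.congr (fun s hs => bdist_add_smul_of_norm_eq hy hxy hs.1 hs.2) ?_
      simp
    have h6 := (uniqueDiffOn_Icc (zero_lt_one (α := ℝ)) 0 (by simp)).eq_deriv _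
      h1.hasDerivWithinAt h4
    have h7 := (fderiv ℝ (bdist Ω) x).le_opNorm (y - x)
    rw [h6, hxy, norm_neg, Real.norm_of_nonneg hpos.le] at h7
    exact le_of_mul_le_mul_right (by linarith) hpos

/-- `Ω` satisfies the exterior ball condition with radius `r`: at each boundary point, a ball of
radius `r` in the complement of `Ω` touches the boundary. -/
def HasExteriorBalls (Ω : Set (EuclideanSpace ℝ (Fin N))) (r : ℝ) : Prop :=
  ∀ y ∈ frontier Ω, ∃ z, ‖y - z‖ = r ∧ Disjoint (Metric.ball z r) Ω

lemma bdist_add_le_norm_sub {x z : EuclideanSpace ℝ (Fin N)} {r : ℝ} (hr : 0 < r) (hx : x ∈ Ω)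
    (hz : Disjoint (Metric.ball z r) Ω) : bdist Ω x ≤ ‖x - z‖ - r := by
  have hxz : r ≤ ‖x - z‖ := by
    by_contra! h
    exact hz.notMem_of_mem_left (by simpa [dist_eq_norm] using h) hx
  have hpos : 0 < ‖x - z‖ := hr.trans_le hxz
  -- every point of the segment that is closer than `r` to `z` lies outside `Ω`
  have key : ∀ s, 0 < s → s < r → bdist Ω x ≤ ‖x - z‖ - s := by
    intro s hs0 hsr
    set y := z + (s / ‖x - z‖) • (x - z)
    have hyz : ‖y - z‖ = s := by
      rw [add_sub_cancel_left, norm_smul, Real.norm_eq_abs, abs_of_nonneg (by positivity)]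
      field_simp
    have hy : y ∉ Ω := hz.notMem_of_mem_left (by rw [mem_ball_iff_norm, hyz]; exact hsr)
    obtain ⟨w, hw, hwf⟩ := exists_mem_frontier_of_segment hx hy
    have h1 : ‖x - y‖ = ‖x - z‖ - s := by
      rw [show x - y = (1 - s / ‖x - z‖) • (x - z) by simp only [y]; module, norm_smul,
        Real.norm_eq_abs, abs_of_nonneg (by
          rw [sub_nonneg, div_le_one hpos]; linarith)]
      field_simp
    have h2 : ‖x - w‖ ≤ ‖x - y‖ := by
      have := dist_add_dist_of_mem_segment hw
      rw [← dist_eq_norm, ← dist_eq_norm]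
      linarith [dist_nonneg (x := w) (y := y)]
    linarith [bdist_le_norm_sub (x := x) hwf]
  refine le_of_forall_pos_le_add fun e he => ?_
  have h := key (max (r / 2) (r - e)) (lt_max_of_lt_left (by linarith))
    (max_lt (by linarith) (by linarith))
  linarith [le_max_right (r / 2) (r - e)]

lemma norm_add_add_norm_sub_le {E : Type*} [NormedAddCommGroup E] [InnerProductSpace ℝ E]
    {a v : E} {r : ℝ} (hr : 0 < r) (ha : r ≤ ‖a‖) :
    ‖a + v‖ + ‖a - v‖ - 2 * ‖a‖ ≤ ‖v‖ ^ 2 / r := by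
  have hpar := parallelogram_law_with_norm ℝ a v
  have h1 : ‖v‖ ^ 2 / ‖a‖ ≤ ‖v‖ ^ 2 / r := by gcongr
  refine le_trans ?_ h1
  have ha0 : 0 < ‖a‖ := hr.trans_le ha
  set b := ‖v‖ ^ 2 / ‖a‖ with hb
  have hb0 : 0 ≤ b := by positivity
  have hbv : b * ‖a‖ = ‖v‖ ^ 2 := by rw [hb]; field_simp
  have : (‖a + v‖ + ‖a - v‖) ^ 2 ≤ (2 * ‖a‖ + b) ^ 2 := by
    nlinarith [sq_nonneg (‖a + v‖ - ‖a - v‖), sq_nonneg b]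
  linarith [(abs_le.1 (abs_le_of_sq_le_sq this (by positivity))).2]

/-- Semiconcavity of the distance function: `δ` is the infimum of the functions `|x - z| - r`,
where `z` runs over the centres of the exterior balls, and these have second differences of size
at most `1 / r`. -/
lemma bdist_second_difference_le (hne : (frontier Ω).Nonempty) {r : ℝ} (hr : 0 < r)
    (hB : HasExteriorBalls Ω r) {x v : EuclideanSpace ℝ (Fin N)} (hx : x ∈ Ω)
    (hp : x + v ∈ Ω) (hm : x - v ∈ Ω) :
    bdist Ω (x + v) + bdist Ω (x - v) - 2 * bdist Ω x ≤ ‖v‖ ^ 2 / r := by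
  obtain ⟨y, hy, hxy⟩ := exists_mem_frontier_norm_sub_eq_bdist hne x
  obtain ⟨z, hyz, hz⟩ := hB y hy
  have h0 := bdist_add_le_norm_sub hr hx hz
  have h1 := bdist_add_le_norm_sub hr hp hz
  have h2 := bdist_add_le_norm_sub hr hm hz
  have h3 : ‖x - z‖ ≤ bdist Ω x + r := by
    rw [← hxy, ← hyz, norm_sub_rev y x]
    simpa using norm_add_le (x - y) (y - z)
  have h4 : r ≤ ‖x - z‖ := by linarith [bdist_nonneg (Ω := Ω) x]
  have h5 := norm_add_add_norm_sub_le (v := v) hr h4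
  rw [show x - z + v = x + v - z by abel, show x - z - v = x - v - z by abel] at h5
  linarith

/-- Around a point where a defining function is `C²` with nonzero differential, the boundary
points have exterior balls of a common radius: the ball lies where the linear part of the
defining function beats the quadratic remainder. -/
lemma exists_exteriorBall_nhds (hΩ : IsBoundedC2Domain Ω) {x₀ : EuclideanSpace ℝ (Fin N)}
    (hx₀ : x₀ ∈ frontier Ω) :
    ∃ r₀ > 0, ∀ᶠ y in 𝓝 x₀, y ∈ frontier Ω → ∀ r, 0 < r → r ≤ r₀ →
      ∃ z, ‖y - z‖ = r ∧ Disjoint (Metric.ball z r) Ω := by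
  obtain ⟨U, ρ, hU, hxU, hρ, hρ', hΩρ⟩ := hΩ.exists_defining x₀ hx₀
  have hC2 : ContDiffAt ℝ 2 ρ x₀ := hρ.contDiffAt (hU.mem_nhds hxU)
  have hC1 : ContDiffAt ℝ 1 (fderiv ℝ ρ) x₀ := hC2.fderiv_right (by norm_num)
  obtain ⟨K, t, ht, hK⟩ := hC1.exists_lipschitzOnWith
  obtain ⟨d, hd, hball⟩ := Metric.mem_nhds_iff.1 (Filter.inter_mem ht (hU.mem_nhds hxU))
  set m := ‖fderiv ℝ ρ x₀‖ / 2 with hm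
  have hm0 : 0 < m := by have := norm_pos_iff.2 (hρ' x₀ hxU); positivity
  have hgrad : ∀ᶠ y in 𝓝 x₀, m < ‖fderiv ℝ ρ y‖ :=
    hC1.continuousAt.norm.eventually_const_lt (by linarith)
  set r₀ := min (d / 8) (m / (2 * (K + 1)))
  have hK1 : (0 : ℝ) < K + 1 := by positivity
  refine ⟨r₀, by positivity, ?_⟩
  filter_upwards [hgrad, Metric.ball_mem_nhds x₀ (half_pos hd)] with y hy hyd hyf r hr hrr
  have hyU : y ∈ U := (hball (Metric.ball_subset_ball (by linarith) hyd)).2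
  have hyΩ : y ∉ Ω := fun h => (hΩ.isOpen.frontier_eq ▸ hyf).2 h
  have hρy : 0 ≤ ρ y := not_lt.1 fun h => hyΩ ((hΩρ y hyU).2 h)
  have hg0 : 0 < ‖fderiv ℝ ρ y‖ := hm0.trans hy
  set g := (InnerProductSpace.toDual ℝ (EuclideanSpace ℝ (Fin N))).symm (fderiv ℝ ρ y) with hg
  have hgn : ‖g‖ = ‖fderiv ℝ ρ y‖ := by simp [hg]
  have hgi : ∀ v, fderiv ℝ ρ y v = inner ℝ g v := fun v => by simp [hg]
  set ν := ‖g‖⁻¹ • g with hν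
  have hg0' : 0 < ‖g‖ := hgn ▸ hg0
  have hνn : ‖ν‖ = 1 := by rw [hν, norm_smul, norm_inv, norm_norm, inv_mul_cancel₀ hg0'.ne']
  refine ⟨y + r • ν, by simp [norm_smul, hνn, abs_of_pos hr], ?_⟩
  rw [Set.disjoint_left]
  intro x hxb hxΩ
  have hrd : r ≤ d / 8 := hrr.trans (min_le_left _ _)
  have hrm : r * (2 * (K + 1)) ≤ m := (le_div_iff₀ (by positivity)).1 (hrr.trans (min_le_right _ _))
  have hxz : ‖(x - y) - r • ν‖ < r := by
    rw [mem_ball_iff_norm] at hxb; rwa [sub_sub]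
  have hxy : ‖x - y‖ < 2 * r := by
    have h1 : ‖x - y‖ ≤ ‖(x - y) - r • ν‖ + ‖r • ν‖ := by
      simpa using norm_add_le ((x - y) - r • ν) (r • ν)
    rw [norm_smul, hνn, Real.norm_of_nonneg hr.le] at h1
    linarith
  have hxd : x ∈ Metric.ball x₀ d := by
    rw [mem_ball_iff_norm] at hyd ⊢
    calc ‖x - x₀‖ ≤ ‖x - y‖ + ‖y - x₀‖ := by simpa using norm_add_le (x - y) (y - x₀)
      _ < d := by linarith
  have hyd' : y ∈ Metric.ball x₀ d := Metric.ball_subset_ball (by linarith) hyd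
  have hρx : ρ x < 0 := (hΩρ x (hball hxd).2).1 hxΩ
  have hsub : segment ℝ y x ⊆ Metric.ball x₀ d := (convex_ball x₀ d).segment_subset hyd' hxd
  have htaylor : ‖ρ x - ρ y - fderiv ℝ ρ y (x - y)‖ ≤ (K * ‖x - y‖) * ‖x - y‖ := by
    refine Convex.norm_image_sub_le_of_norm_fderiv_le' (s := segment ℝ y x) (𝕜 := ℝ) ?_ ?_
      (convex_segment y x) (left_mem_segment ℝ y x) (right_mem_segment ℝ y x)
    · intro w hw
      exact (hρ.contDiffAt (hU.mem_nhds (hball (hsub hw)).2)).differentiableAt (by norm_num)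
    · intro w hw
      have h1 := hK.dist_le_mul w (hball (hsub hw)).1 y (hball hyd').1
      rw [dist_eq_norm, dist_eq_norm] at h1
      refine h1.trans ?_
      gcongr
      have := dist_add_dist_of_mem_segment hw
      rw [← dist_eq_norm, dist_comm, ← dist_eq_norm, dist_comm x y]
      linarith [dist_nonneg (x := w) (y := x)]
  have hsq : ‖x - y‖ ^ 2 < 2 * r * inner ℝ (x - y) ν := by
    have h1 := norm_sub_sq_real (x - y) (r • ν)
    rw [inner_smul_right, norm_smul, hνn, Real.norm_of_nonneg hr.le] at h1
    nlinarith [norm_nonneg ((x - y) - r • ν)]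
  have hlin : fderiv ℝ ρ y (x - y) = ‖g‖ * inner ℝ (x - y) ν := by
    rw [hgi, hν, inner_smul_right, real_inner_comm]
    field_simp
  have h2 := (abs_le.1 htaylor).1
  have hin : 0 < inner ℝ (x - y) ν := by nlinarith [sq_nonneg ‖x - y‖]
  have h3 : m * inner ℝ (x - y) ν ≤ ‖g‖ * inner ℝ (x - y) ν := by
    rw [hgn]; gcongr
  have h4 : K * ‖x - y‖ ^ 2 ≤ (K + 1) * (2 * r * inner ℝ (x - y) ν) := by
    have : (0 : ℝ) ≤ K := K.2
    nlinarith [sq_nonneg ‖x - y‖]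
  have h5 : r * (2 * (K + 1)) * inner ℝ (x - y) ν ≤ m * inner ℝ (x - y) ν := by gcongr
  nlinarith

lemma exists_hasExteriorBalls (hΩ : IsBoundedC2Domain Ω) : ∃ r > 0, HasExteriorBalls Ω r := by
  have hc : IsCompact (frontier Ω) :=
    Metric.isCompact_of_isClosed_isBounded isClosed_frontier
      (hΩ.isBounded.closure.subset frontier_subset_closure)
  have key : ∃ r₀ > 0, ∀ y ∈ frontier Ω, y ∈ frontier Ω → ∀ r, 0 < r → r ≤ r₀ →
      ∃ z, ‖y - z‖ = r ∧ Disjoint (Metric.ball z r) Ω := by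
    refine hc.induction_on (p := fun S => ∃ r₀ > 0, ∀ y ∈ S, y ∈ frontier Ω →
      ∀ r, 0 < r → r ≤ r₀ → ∃ z, ‖y - z‖ = r ∧ Disjoint (Metric.ball z r) Ω)
      ⟨1, one_pos, by simp⟩ ?_ ?_ ?_
    · rintro S T hST ⟨r₀, h0, h⟩
      exact ⟨r₀, h0, fun y hy => h y (hST hy)⟩
    · rintro S T ⟨r₁, h1, H1⟩ ⟨r₂, h2, H2⟩
      refine ⟨min r₁ r₂, lt_min h1 h2, fun y hy hyf r hr hrr => ?_⟩
      rcases hy with hy | hy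
      · exact H1 y hy hyf r hr (hrr.trans (min_le_left _ _))
      · exact H2 y hy hyf r hr (hrr.trans (min_le_right _ _))
    · intro x hx
      obtain ⟨r₀, h0, h⟩ := exists_exteriorBall_nhds hΩ hx
      exact ⟨_, mem_nhdsWithin_of_mem_nhds h, r₀, h0, fun y hy => hy⟩
  obtain ⟨r₀, h0, h⟩ := key
  exact ⟨r₀, h0, fun y hy => h y hy hy r₀ h0 le_rfl⟩

end Distance

/-! ### An integrated upper bound for the Laplacian of the distance function -/

section Laplacian

lemma integral_difference_mul_difference {E : Type*} [NormedAddCommGroup E] [MeasurableSpace E]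
    [BorelSpace E] (μ : Measure E) [IsFiniteMeasureOnCompacts μ]
    [μ.IsAddRightInvariant] {ζ w : E → ℝ} (hζ : Continuous ζ) (hc : HasCompactSupport ζ)
    (hw : Continuous w) (v : E) :
    ∫ x, (ζ (x + v) - ζ x) * (w (x + v) - w x) ∂μ
      = -∫ x, ζ x * (w (x + v) + w (x - v) - 2 * w x) ∂μ := by
  have hc' : HasCompactSupport fun x => ζ (x + v) := hc.comp_homeomorph (Homeomorph.addRight v)
  have i1 : Integrable (fun x => ζ (x + v) * (w (x + v) - w x)) μ :=
    Continuous.integrable_of_hasCompactSupport (by fun_prop) hc'.mul_right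
  have i2 : Integrable (fun x => ζ x * (w (x + v) - w x)) μ :=
    Continuous.integrable_of_hasCompactSupport (by fun_prop) hc.mul_right
  have i3 : Integrable (fun x => ζ x * (w x - w (x - v))) μ :=
    Continuous.integrable_of_hasCompactSupport (by fun_prop) hc.mul_right
  have h1 : ∫ x, ζ (x + v) * (w (x + v) - w x) ∂μ = ∫ x, ζ x * (w x - w (x - v)) ∂μ := by
    simpa using integral_add_right_eq_self (μ := μ) (fun x => ζ x * (w x - w (x - v))) v
  simp_rw [sub_mul]
  rw [integral_sub i1 i2, h1, ← integral_sub i3 i2, ← integral_neg]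
  congr 1 with x
  ring

lemma tendsto_integral_difference_mul_difference {E : Type*} [NormedAddCommGroup E]
    [NormedSpace ℝ E] [FiniteDimensional ℝ E] [MeasurableSpace E] [BorelSpace E] (μ : Measure E)
    [μ.IsAddHaarMeasure] {ζ w : E → ℝ} {C D : NNReal} (hζ : LipschitzWith C ζ)
    (hc : HasCompactSupport ζ) (hw : LipschitzWith D w) (v : E) :
    Tendsto (fun t : ℝ => ∫ x, (t⁻¹ * (ζ (x + t • v) - ζ x)) * (t⁻¹ * (w (x + t • v) - w x)) ∂μ)
      (𝓝[>] 0) (𝓝 (∫ x, fderiv ℝ ζ x v * fderiv ℝ w x v ∂μ)) := by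
  have hK : IsCompact (Metric.cthickening ‖v‖ (tsupport ζ)) := hc.isCompact.cthickening
  refine tendsto_integral_filter_of_dominated_convergence
    ((Metric.cthickening ‖v‖ (tsupport ζ)).indicator fun _ => (C * ‖v‖) * (D * ‖v‖)) ?_ ?_ ?_ ?_
  · have := hζ.continuous
    have := hw.continuous
    exact Eventually.of_forall fun t => Continuous.aestronglyMeasurable (by fun_prop)
  · have ht1 : ∀ᶠ t : ℝ in 𝓝[>] 0, t ≤ 1 :=
      mem_nhdsWithin_of_mem_nhds (Iic_mem_nhds one_pos)
    filter_upwards [self_mem_nhdsWithin, ht1] with t (ht : 0 < t) ht1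
    refine Eventually.of_forall fun x => ?_
    have hquot : ∀ {f : E → ℝ} {A : NNReal}, LipschitzWith A f →
        ‖t⁻¹ * (f (x + t • v) - f x)‖ ≤ A * ‖v‖ := by
      intro f A hf
      have h1 := hf.dist_le_mul (x + t • v) x
      rw [dist_eq_norm, dist_eq_norm, add_sub_cancel_left, norm_smul,
        Real.norm_of_nonneg ht.le] at h1
      rw [norm_mul, norm_inv, Real.norm_of_nonneg ht.le, inv_mul_le_iff₀ ht]
      linarith
    by_cases hx : x ∈ Metric.cthickening ‖v‖ (tsupport ζ)
    · rw [Set.indicator_of_mem hx, norm_mul]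
      exact mul_le_mul (hquot hζ) (hquot hw) (norm_nonneg _) (by positivity)
    · have h1 : ζ x = 0 := image_eq_zero_of_notMem_tsupport
        fun h => hx (Metric.self_subset_cthickening _ h)
      have h2 : ζ (x + t • v) = 0 := image_eq_zero_of_notMem_tsupport fun h => hx <| by
        refine Metric.mem_cthickening_of_dist_le x (x + t • v) _ _ h ?_
        rw [dist_eq_norm, sub_add_cancel_left, norm_neg, norm_smul, Real.norm_of_nonneg ht.le]
        exact mul_le_of_le_one_left (norm_nonneg v) ht1
      simp [hx, h1, h2]
  · exact (integrable_indicator_iff hK.measurableSet).2 (integrableOn_const hK.measure_lt_top.ne)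
  · filter_upwards [hζ.ae_differentiableAt (μ := μ), hw.ae_differentiableAt (μ := μ)] with x h1 h2
    have hl : ∀ {f : E → ℝ}, DifferentiableAt ℝ f x →
        Tendsto (fun t : ℝ => t⁻¹ * (f (x + t • v) - f x)) (𝓝[>] 0) (𝓝 (fderiv ℝ f x v)) := by
      intro f hf
      exact ((hf.hasFDerivAt.hasLineDerivAt v).tendsto_slope_zero).mono_left
        (nhdsWithin_mono _ fun _ ht => ne_of_gt ht)
    exact (hl h1).mul (hl h2)

variable {N : ℕ} {Ω : Set (EuclideanSpace ℝ (Fin N))}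

/-- The inequality `∂ᵥ²δ ≤ 1 / r`, tested against `ζ` and integrated by parts once. -/
lemma neg_integral_le_integral_fderiv_mul_fderiv_bdist (hΩ : IsOpen Ω)
    (hne : (frontier Ω).Nonempty) {r : ℝ} (hr : 0 < r) (hB : HasExteriorBalls Ω r)
    {ζ : EuclideanSpace ℝ (Fin N) → ℝ} {C : NNReal} (hζ : LipschitzWith C ζ)
    (hc : HasCompactSupport ζ) (hsub : tsupport ζ ⊆ Ω) (h0 : ∀ x, 0 ≤ ζ x)
    {v : EuclideanSpace ℝ (Fin N)} (hv : ‖v‖ = 1) :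
    -(1 / r * ∫ x, ζ x) ≤ ∫ x, fderiv ℝ ζ x v * fderiv ℝ (bdist Ω) x v := by
  obtain ⟨d, hd, hdΩ⟩ := hc.isCompact.exists_thickening_subset_open hΩ hsub
  have ht1 : ∀ᶠ t : ℝ in 𝓝[>] 0, t < d := mem_nhdsWithin_of_mem_nhds (Iio_mem_nhds hd)
  refine ge_of_tendsto (tendsto_integral_difference_mul_difference volume hζ hc
    (lipschitzWith_bdist Ω) v) ?_
  filter_upwards [self_mem_nhdsWithin, ht1] with t (ht : 0 < t) htd
  have hcont := continuous_bdist Ω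
  have e1 : ∫ x, (t⁻¹ * (ζ (x + t • v) - ζ x)) * (t⁻¹ * (bdist Ω (x + t • v) - bdist Ω x))
      = -((t ^ 2)⁻¹ * ∫ x, ζ x * (bdist Ω (x + t • v) + bdist Ω (x - t • v) - 2 * bdist Ω x)) := by
    rw [← mul_neg, ← integral_difference_mul_difference volume hζ.continuous hc hcont (t • v),
      ← integral_const_mul]
    congr 1 with x
    field_simp
  rw [e1, neg_le_neg_iff, inv_mul_le_iff₀ (by positivity), ← integral_const_mul,
    ← integral_const_mul]
  have hζc := hζ.continuous
  refine integral_mono (Continuous.integrable_of_hasCompactSupport (by fun_prop) hc.mul_right)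
    (((hζc.integrable_of_hasCompactSupport hc).const_mul _).const_mul _) fun x => ?_
  by_cases hx : x ∈ tsupport ζ
  · have hmem : ∀ s : ℝ, |s| = t → x + s • v ∈ Ω := by
      intro s hs
      refine hdΩ (Metric.mem_thickening_iff.2 ⟨x, hx, ?_⟩)
      rw [dist_eq_norm, add_sub_cancel_left, norm_smul, hv, Real.norm_eq_abs, hs, mul_one]
      exact htd
    have h1 := bdist_second_difference_le hne hr hB (hsub hx) (hmem t (abs_of_pos ht))
      (by
        have := hmem (-t) (by rw [abs_neg, abs_of_pos ht])
        rwa [neg_smul, ← sub_eq_add_neg] at this)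
    rw [norm_smul, hv, Real.norm_of_nonneg ht.le, mul_one] at h1
    calc _ ≤ ζ x * (t ^ 2 / r) := by gcongr; exact h0 x
      _ = _ := by ring
  · simp [image_eq_zero_of_notMem_tsupport hx]

lemma sum_mul_eq_inner (f g : StrongDual ℝ (EuclideanSpace ℝ (Fin N))) :
    ∑ i, f (EuclideanSpace.basisFun (Fin N) ℝ i) * g (EuclideanSpace.basisFun (Fin N) ℝ i)
      = inner ℝ ((InnerProductSpace.toDual ℝ _).symm f)
        ((InnerProductSpace.toDual ℝ _).symm g) := by
  rw [← (EuclideanSpace.basisFun (Fin N) ℝ).sum_inner_mul_inner]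
  refine Finset.sum_congr rfl fun i _ => ?_
  rw [InnerProductSpace.toDual_symm_apply, real_inner_comm, InnerProductSpace.toDual_symm_apply]

lemma lipschitzWith_mul_comp_bdist {ψ : EuclideanSpace ℝ (Fin N) → ℝ} (hψ : ContDiff ℝ 1 ψ)
    (hψc : HasCompactSupport ψ) {k : ℝ → ℝ} (hk : ContDiff ℝ 1 k) (hkc : HasCompactSupport k) :
    ∃ C, LipschitzWith C fun x => ψ x * k (bdist Ω x) := by
  obtain ⟨A, hA⟩ := hψ.lipschitzWith_of_hasCompactSupport hψc one_ne_zero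
  obtain ⟨B, hB⟩ := hk.lipschitzWith_of_hasCompactSupport hkc one_ne_zero
  obtain ⟨a, ha⟩ := hψc.exists_bound_of_continuous hψ.continuous
  obtain ⟨b, hb⟩ := hkc.exists_bound_of_continuous hk.continuous
  have ha0 := (norm_nonneg _).trans (ha 0)
  have hb0 := (norm_nonneg _).trans (hb 0)
  refine ⟨Real.toNNReal (A * b + a * B), LipschitzWith.of_dist_le_mul fun x y => ?_⟩
  rw [Real.coe_toNNReal _ (by positivity), dist_eq_norm, dist_eq_norm]
  have h1 := hA.dist_le_mul x y
  have h2 := (hB.comp (lipschitzWith_bdist Ω)).dist_le_mul x y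
  rw [dist_eq_norm, dist_eq_norm] at h1 h2
  simp only [Function.comp_apply, mul_one] at h2
  rw [show ψ x * k (bdist Ω x) - ψ y * k (bdist Ω y) = (ψ x - ψ y) * k (bdist Ω x)
    + ψ y * (k (bdist Ω x) - k (bdist Ω y)) by ring]
  refine (norm_add_le _ _).trans ?_
  rw [norm_mul, norm_mul, add_mul]
  refine add_le_add ?_ ?_
  · calc _ ≤ (A * ‖x - y‖) * b := mul_le_mul h1 (hb _) (norm_nonneg _) (by positivity)
      _ = _ := by ring
  · calc _ ≤ a * (B * ‖x - y‖) := mul_le_mul (ha _) h2 (norm_nonneg _) ha0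
      _ = _ := by ring

/-- Integration by parts against the vector field `k(δ) ∇δ`, whose divergence is
`k'(δ) + k(δ) Δδ ≤ k'(δ) + (N / r) k(δ)`. -/
lemma neg_integral_mul_deriv_le_integral_norm_fderiv_mul (hΩ : IsOpen Ω)
    (hne : (frontier Ω).Nonempty) {r : ℝ} (hr : 0 < r) (hB : HasExteriorBalls Ω r)
    {ψ : EuclideanSpace ℝ (Fin N) → ℝ} (hψ : ContDiff ℝ 1 ψ)
    (hψc : HasCompactSupport ψ) (hsub : tsupport ψ ⊆ Ω) (h0 : ∀ x, 0 ≤ ψ x)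
    {k : ℝ → ℝ} (hk : ContDiff ℝ 1 k) (hkc : HasCompactSupport k) (hk0 : ∀ t, 0 ≤ k t) :
    -∫ x, ψ x * (deriv k (bdist Ω x) + N / r * k (bdist Ω x))
      ≤ ∫ x, ‖fderiv ℝ ψ x‖ * k (bdist Ω x) := by
  set b := EuclideanSpace.basisFun (Fin N) ℝ
  set ζ : EuclideanSpace ℝ (Fin N) → ℝ := fun x => ψ x * k (bdist Ω x) with hζ
  obtain ⟨C, hC⟩ := lipschitzWith_mul_comp_bdist (Ω := Ω) hψ hψc hk hkc
  have hζc : HasCompactSupport ζ := hψc.mul_right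
  have hdist := continuous_bdist Ω
  have hkcont := hk.continuous
  have hk'cont := hk.continuous_deriv le_rfl
  have hψcont := hψ.continuous
  have hψ'cont := hψ.continuous_fderiv one_ne_zero
  have i1 : Integrable ζ := hC.continuous.integrable_of_hasCompactSupport hζc
  have i2 : Integrable fun x => ‖fderiv ℝ ψ x‖ * k (bdist Ω x) :=
    Continuous.integrable_of_hasCompactSupport (by fun_prop) (hψc.fderiv ℝ).norm.mul_right
  have i3 : Integrable fun x => ψ x * deriv k (bdist Ω x) :=
    Continuous.integrable_of_hasCompactSupport (by fun_prop) hψc.mul_right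
  have i4 : ∀ i, Integrable fun x => fderiv ℝ ζ x (b i) * fderiv ℝ (bdist Ω) x (b i) := by
    intro i
    have hbd : ∀ x, ‖fderiv ℝ ζ x (b i) * fderiv ℝ (bdist Ω) x (b i)‖
        ≤ (tsupport ζ).indicator (fun _ => (C : ℝ)) x := by
      intro x
      by_cases hx : x ∈ tsupport ζ
      · rw [Set.indicator_of_mem hx, norm_mul]
        have h1 := (fderiv ℝ ζ x).le_opNorm (b i)
        have h2 := (fderiv ℝ (bdist Ω) x).le_opNorm (b i)
        have h3 := norm_fderiv_le_of_lipschitz ℝ hC (x₀ := x)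
        have h4 := norm_fderiv_le_of_lipschitz ℝ (lipschitzWith_bdist Ω) (x₀ := x)
        rw [b.norm_eq_one, mul_one] at h1 h2
        calc _ ≤ (C : ℝ) * ((1 : NNReal) : ℝ) :=
              mul_le_mul (h1.trans h3) (h2.trans h4) (norm_nonneg _) C.2
          _ = C := by simp
      · have : fderiv ℝ ζ x = 0 := image_eq_zero_of_notMem_tsupport
          fun h => hx (tsupport_fderiv_subset ℝ h)
        simp [hx, this]
    refine Integrable.mono' ((integrable_indicator_iff hζc.measurableSet).2
      (integrableOn_const (C := (C : ℝ)) hζc.measure_lt_top.ne)) ?_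
      (Eventually.of_forall hbd)
    exact ((measurable_fderiv_apply_const ℝ ζ (b i)).mul
      (measurable_fderiv_apply_const ℝ (bdist Ω) (b i))).aestronglyMeasurable
  have hsum : -(N / r * ∫ x, ζ x)
      ≤ ∫ x, ∑ i, fderiv ℝ ζ x (b i) * fderiv ℝ (bdist Ω) x (b i) := by
    rw [integral_finsetSum _ fun i _ => i4 i]
    have h1 : ∑ _i : Fin N, -(1 / r * ∫ x, ζ x) = -(N / r * ∫ x, ζ x) := by
      simp; ring
    rw [← h1]
    exact Finset.sum_le_sum fun i _ => neg_integral_le_integral_fderiv_mul_fderiv_bdist hΩ hne hr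
      hB hC hζc ((tsupport_mul_subset_left).trans hsub)
      (fun x => mul_nonneg (h0 x) (hk0 _)) (b.norm_eq_one i)
  have hae : ∀ᵐ x, ∑ i, fderiv ℝ ζ x (b i) * fderiv ℝ (bdist Ω) x (b i)
      ≤ ‖fderiv ℝ ψ x‖ * k (bdist Ω x) + ψ x * deriv k (bdist Ω x) := by
    filter_upwards [(lipschitzWith_bdist Ω).ae_differentiableAt (μ := volume)] with x hx
    have hkx : HasFDerivAt (fun x => k (bdist Ω x))
        (deriv k (bdist Ω x) • fderiv ℝ (bdist Ω) x) x :=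
      ((hk.differentiable one_ne_zero _).hasDerivAt).comp_hasFDerivAt x hx.hasFDerivAt
    have hζx : fderiv ℝ ζ x = ψ x • (deriv k (bdist Ω x) • fderiv ℝ (bdist Ω) x)
        + k (bdist Ω x) • fderiv ℝ ψ x :=
      (((hψ.differentiable one_ne_zero x).hasFDerivAt).mul hkx).fderiv
    rw [sum_mul_eq_inner, hζx]
    simp only [map_add, map_smul, inner_add_left, real_inner_smul_left, real_inner_self_eq_norm_sq,
      LinearIsometryEquiv.norm_map]
    have h1 : inner ℝ ((InnerProductSpace.toDual ℝ _).symm (fderiv ℝ ψ x))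
        ((InnerProductSpace.toDual ℝ _).symm (fderiv ℝ (bdist Ω) x)) ≤ ‖fderiv ℝ ψ x‖ := by
      refine (real_inner_le_norm _ _).trans ?_
      rw [LinearIsometryEquiv.norm_map, LinearIsometryEquiv.norm_map]
      exact mul_le_of_le_one_right (norm_nonneg _)
        (by simpa using norm_fderiv_le_of_lipschitz ℝ (lipschitzWith_bdist Ω) (x₀ := x))
    have h2 : ψ x * (deriv k (bdist Ω x) * ‖fderiv ℝ (bdist Ω) x‖ ^ 2)
        = ψ x * deriv k (bdist Ω x) := by
      by_cases hxΩ : x ∈ Ω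
      · rw [norm_fderiv_bdist hΩ hne hxΩ hx]; ring
      · rw [image_eq_zero_of_notMem_tsupport fun h => hxΩ (hsub h)]; ring
    rw [h2]
    nlinarith [mul_le_mul_of_nonneg_left h1 (hk0 (bdist Ω x))]
  have hle := hsum.trans (integral_mono_ae (integrable_finsetSum _ fun i _ => i4 i)
    (i2.add i3) hae)
  rw [Pi.add_def, integral_add i2 i3] at hle
  have hsplit : ∫ x, ψ x * (deriv k (bdist Ω x) + N / r * k (bdist Ω x))
      = (∫ x, ψ x * deriv k (bdist Ω x)) + N / r * ∫ x, ζ x := by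
    rw [← integral_const_mul, ← integral_add i3 (i1.const_mul _)]
    congr 1 with x
    simp only [hζ]; ring
  rw [hsplit]
  linarith

end Laplacian

/-! ### Surface measure and thin layers -/

section Surface

variable {N : ℕ} {Ω : Set (EuclideanSpace ℝ (Fin N))}

/-- The layer `{x : |δ(x) - (η - ε)| ≤ ε / 2}`, of thickness `ε`, just below the level `η`. -/
def layer (Ω : Set (EuclideanSpace ℝ (Fin N))) (η ε : ℝ) : Set (EuclideanSpace ℝ (Fin N)) :=
  {x | |bdist Ω x - (η - ε)| ≤ ε / 2}

lemma measurableSet_layer (η ε : ℝ) : MeasurableSet (layer Ω η ε) := by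
  have := continuous_bdist Ω
  exact (isClosed_le (by fun_prop) continuous_const).measurableSet

/-- The constant in the comparison of surface measure with the volume of thin layers. -/
noncomputable def layerConst (N : ℕ) : ℝ :=
  20 ^ (N - 1) * 2 ^ N / (volume (Metric.ball (0 : EuclideanSpace ℝ (Fin N)) 1)).toReal

lemma layerConst_pos (N : ℕ) : 0 < layerConst N := by
  have : 0 < (volume (Metric.ball (0 : EuclideanSpace ℝ (Fin N)) 1)).toReal :=
    ENNReal.toReal_pos (Metric.measure_ball_pos _ _ one_pos).ne' measure_ball_lt_top.ne
  unfold layerConst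
  positivity

lemma ofReal_rpow_eq_layerConst_mul (hN : 1 ≤ N) {ε : ℝ} (hε : 0 < ε)
    (x : EuclideanSpace ℝ (Fin N)) :
    ENNReal.ofReal (20 * ε) ^ (((N - 1 : ℕ) : ℝ))
      = ENNReal.ofReal (layerConst N) * (ENNReal.ofReal (1 / ε)
        * volume (Metric.ball x (ε / 2))) := by
  have hv : 0 < (volume (Metric.ball (0 : EuclideanSpace ℝ (Fin N)) 1)).toReal :=
    ENNReal.toReal_pos (Metric.measure_ball_pos _ _ one_pos).ne' measure_ball_lt_top.ne
  have hvt : volume (Metric.ball (0 : EuclideanSpace ℝ (Fin N)) 1) ≠ ⊤ := measure_ball_lt_top.ne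
  have hl := layerConst_pos N
  rw [Measure.addHaar_ball_of_pos _ _ (by positivity), finrank_euclideanSpace_fin,
    ← ENNReal.ofReal_toReal hvt, ← ENNReal.ofReal_mul (by positivity),
    ← ENNReal.ofReal_mul (by positivity), ← ENNReal.ofReal_mul hl.le, ENNReal.rpow_natCast,
    ← ENNReal.ofReal_pow (by positivity), layerConst]
  congr 1
  obtain ⟨M, rfl⟩ : ∃ M, N = M + 1 := ⟨N - 1, by omega⟩
  rw [Nat.add_sub_cancel, div_pow, mul_pow]
  field_simp
  ring

/-- The Hausdorff measure of a piece of a level set is controlled by the volume of the thin layers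
below it: a Vitali family of balls of radius comparable to `ε` covers the piece, and each of these
balls contains a ball of radius `ε / 2` of the layer. -/
lemma hausdorffMeasure_le_liminf_volume_layer (hN : 1 ≤ N) (hne : (frontier Ω).Nonempty) {η : ℝ}
    (hη : 0 < η) {S V : Set (EuclideanSpace ℝ (Fin N))} (hS : ∀ x ∈ S, bdist Ω x = η)
    (hV : ∀ᶠ ε : ℝ in 𝓝[>] 0, ∀ x ∈ S, Metric.closedBall x (2 * ε) ⊆ V) :
    μH[((N - 1 : ℕ) : ℝ)] S ≤ ENNReal.ofReal (layerConst N) *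
      liminf (fun ε => ENNReal.ofReal (1 / ε) * volume (layer Ω η ε ∩ V)) (𝓝[>] 0) := by
  have hvit : ∀ ε : ℝ, ∃ u : Set (EuclideanSpace ℝ (Fin N)), u.Countable ∧ (0 < ε → u ⊆ S ∧
      (u.PairwiseDisjoint fun a => Metric.closedBall a (2 * ε)) ∧
      ∀ a ∈ S, ∃ b ∈ u, Metric.closedBall a (2 * ε) ⊆ Metric.closedBall b (5 * (2 * ε))) := by
    intro ε
    by_cases hε : 0 < ε
    · obtain ⟨u, hu, hd, hc⟩ := Vitali.exists_disjoint_subfamily_covering_enlargement_closedBall S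
        (fun a => a) (fun _ => 2 * ε) (2 * ε) (fun _ _ => le_rfl) 5 (by norm_num)
      refine ⟨u, ?_, fun _ => ⟨hu, hd, hc⟩⟩
      refine hd.countable_of_nonempty_interior fun a _ => ⟨a, ?_⟩
      exact Metric.ball_subset_interior_closedBall (Metric.mem_ball_self (by positivity))
    · exact ⟨∅, Set.countable_empty, fun h => absurd h hε⟩
  choose u hu hprop using hvit
  have hcount : ∀ ε, Countable (u ε) := fun ε => (hu ε).to_subtype
  have hpos : ∀ᶠ ε : ℝ in 𝓝[>] 0, 0 < ε := self_mem_nhdsWithin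
  have hsmall : ∀ᶠ ε : ℝ in 𝓝[>] 0, ε ≤ η := mem_nhdsWithin_of_mem_nhds (Iic_mem_nhds hη)
  have hdiam : ∀ (ε : ℝ) (i : u ε), Metric.ediam (Metric.closedBall (i : EuclideanSpace ℝ (Fin N))
      (5 * (2 * ε))) ≤ ENNReal.ofReal (20 * ε) := by
    intro ε i
    refine Metric.ediam_le_of_forall_dist_le fun x hx y hy => ?_
    have := dist_triangle_right x y (i : EuclideanSpace ℝ (Fin N))
    rw [Metric.mem_closedBall] at hx hy
    linarith
  have h1 := Measure.hausdorffMeasure_le_liminf_tsum ((N - 1 : ℕ) : ℝ) S (l := 𝓝[>] (0 : ℝ))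
    (fun ε => ENNReal.ofReal (20 * ε))
    (by
      have : Tendsto (fun ε : ℝ => ENNReal.ofReal (20 * ε)) (𝓝 0) (𝓝 (ENNReal.ofReal (20 * 0))) :=
        (ENNReal.continuous_ofReal.comp (continuous_const.mul continuous_id)).tendsto 0
      simpa using this.mono_left nhdsWithin_le_nhds)
    (fun ε (i : u ε) => Metric.closedBall (i : EuclideanSpace ℝ (Fin N)) (5 * (2 * ε)))
    (Eventually.of_forall fun ε i => hdiam ε i)
    (by
      filter_upwards [hpos] with ε hε a ha
      obtain ⟨b, hb, hab⟩ := (hprop ε hε).2.2 a ha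
      exact Set.mem_iUnion.2 ⟨⟨b, hb⟩, hab (Metric.mem_closedBall_self (by positivity))⟩)
  rw [← ENNReal.liminf_const_mul_of_ne_top ENNReal.ofReal_ne_top]
  refine h1.trans (liminf_le_liminf ?_)
  filter_upwards [hpos, hsmall, hV] with ε hε hεη hεV
  obtain ⟨huS, hdisj, -⟩ := hprop ε hε
  have hx' : ∀ i : u ε, ∃ x', ‖x' - (i : EuclideanSpace ℝ (Fin N))‖ = ε ∧ bdist Ω x' = η - ε := by
    intro i
    have hi := hS i (huS i.2)
    obtain ⟨x', h1, h2⟩ := exists_norm_sub_eq_bdist_eq_sub hne hε.le (hi ▸ hεη) (hi ▸ hη)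
    exact ⟨x', h1, hi ▸ h2⟩
  choose c hc1 hc2 using hx'
  have hsub : ∀ i : u ε, Metric.ball (c i) (ε / 2) ⊆ Metric.closedBall i (2 * ε) := by
    intro i w hw
    rw [mem_ball_iff_norm] at hw
    rw [mem_closedBall_iff_norm]
    calc ‖w - i‖ ≤ ‖w - c i‖ + ‖c i - i‖ := by simpa using norm_add_le (w - c i) (c i - i)
      _ ≤ 2 * ε := by rw [hc1]; linarith
  calc ∑' i : u ε, Metric.ediam (Metric.closedBall (i : EuclideanSpace ℝ (Fin N)) (5 * (2 * ε)))
        ^ (((N - 1 : ℕ) : ℝ))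
      ≤ ∑' i : u ε, ENNReal.ofReal (layerConst N) * (ENNReal.ofReal (1 / ε)
        * volume (Metric.ball (c i) (ε / 2))) := by
        refine ENNReal.tsum_le_tsum fun i => ?_
        rw [← ofReal_rpow_eq_layerConst_mul hN hε]
        exact ENNReal.rpow_le_rpow (hdiam ε i) (by positivity)
    _ = ENNReal.ofReal (layerConst N) * (ENNReal.ofReal (1 / ε)
        * volume (⋃ i : u ε, Metric.ball (c i) (ε / 2))) := by
        rw [ENNReal.tsum_mul_left, ENNReal.tsum_mul_left, measure_iUnion]
        · intro i j hij
          exact (hdisj i.2 j.2 (fun h => hij (Subtype.ext h))).mono (hsub i) (hsub j)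
        · exact fun i => measurableSet_ball
    _ ≤ _ := by
        gcongr
        refine Set.iUnion_subset fun i w hw => ⟨?_, hεV i (huS i.2) (hsub i hw)⟩
        have := abs_bdist_sub_le (Ω := Ω) w (c i)
        rw [hc2] at this
        rw [mem_ball_iff_norm] at hw
        exact this.trans hw.le

/-- The constant of the trace estimate: `layerConst`, times the normalization of Hausdorff measure,
times `2` for the passage from `{ψ ≥ t}` to `{ψ > t / 2}` in the layer cake formula. -/
noncomputable def surfaceConst (N : ℕ) : ℝ :=
  2 * layerConst N * (Measure.addHaarScalarFactor
    (volume : Measure (EuclideanSpace ℝ (Fin (N - 1)))) μH[((N - 1 : ℕ) : ℝ)])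

lemma surfaceConst_nonneg (N : ℕ) : 0 ≤ surfaceConst N := by
  have := (layerConst_pos N).le
  unfold surfaceConst
  positivity

/-- The integral over `Σ_η` is controlled by the averages over the thin layers just below it. -/
lemma lintegral_surfaceMeasure_le_liminf (hN : 1 ≤ N) (hne : (frontier Ω).Nonempty) {η : ℝ}
    (hη : 0 < η) {ψ : EuclideanSpace ℝ (Fin N) → ℝ} {A : NNReal} (hψ : LipschitzWith A ψ)
    (h0 : ∀ x, 0 ≤ ψ x) :
    ∫⁻ x, ENNReal.ofReal (ψ x) ∂(surfaceMeasure Ω η) ≤ ENNReal.ofReal (surfaceConst N) *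
      liminf (fun ε => ENNReal.ofReal (1 / ε) * ∫⁻ x in layer Ω η ε, ENNReal.ofReal (ψ x))
        (𝓝[>] 0) := by
  set c₁ := Measure.addHaarScalarFactor (volume : Measure (EuclideanSpace ℝ (Fin (N - 1))))
    μH[((N - 1 : ℕ) : ℝ)] with hc₁
  have hψc := hψ.continuous
  -- for fixed `t > 0`, all points within `2ε` of `{ψ ≥ t}` lie in `{2ψ > t}` once `ε` is small;
  -- the factor `2` keeps the error multiplicative, so no bound on the volume of the layer is needed
  have hslice : ∀ t : ℝ, 0 < t → surfaceMeasure Ω η {x | t ≤ ψ x}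
      ≤ c₁ * ENNReal.ofReal (layerConst N) * liminf (fun ε => ENNReal.ofReal (1 / ε) *
        (volume.restrict (layer Ω η ε)) {x | t < 2 * ψ x}) (𝓝[>] 0) := by
    intro t ht
    have hm : MeasurableSet {x | t ≤ ψ x} := (isClosed_le continuous_const hψc).measurableSet
    have hm2 : MeasurableSet {x | t < 2 * ψ x} :=
      (isOpen_lt continuous_const (continuous_const.mul hψc)).measurableSet
    rw [surfaceMeasure, Measure.restrict_apply hm, Measure.euclideanHausdorffMeasure_def,
      Measure.smul_apply, ENNReal.smul_def, smul_eq_mul, mul_assoc]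
    gcongr
    have h1 := hausdorffMeasure_le_liminf_volume_layer (Ω := Ω) (S := {x | t ≤ ψ x} ∩ level Ω η)
      (V := {x | t < 2 * ψ x}) hN hne hη (fun x hx => hx.2.2) ?_
    · refine h1.trans (le_of_eq ?_)
      simp_rw [Measure.restrict_apply hm2, Set.inter_comm]
    · have hε : ∀ᶠ ε : ℝ in 𝓝[>] 0, ε < t / (4 * (A + 1)) :=
        mem_nhdsWithin_of_mem_nhds (Iio_mem_nhds (by positivity))
      filter_upwards [hε, self_mem_nhdsWithin] with ε hε (hε0 : 0 < ε) x hx w hw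
      have h2 := hψ.dist_le_mul x w
      rw [Real.dist_eq] at h2
      rw [Metric.mem_closedBall, dist_comm] at hw
      rw [lt_div_iff₀ (by positivity)] at hε
      have h3 : (A : ℝ) * dist x w ≤ A * (2 * ε) := by gcongr
      have h4 := (abs_le.1 h2).2
      have h5 : t ≤ ψ x := hx.1
      simp only [Set.mem_ofPred_eq]
      nlinarith
  rw [lintegral_eq_lintegral_meas_le _ (Eventually.of_forall h0) hψc.measurable.aemeasurable]
  have hmeas : ∀ ε : ℝ, Measurable fun t : ℝ => ENNReal.ofReal (1 / ε) *
      (volume.restrict (layer Ω η ε)) {x | t < 2 * ψ x} := by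
    intro ε
    refine Measurable.const_mul (Antitone.measurable fun s t hst => measure_mono fun x hx => ?_) _
    exact lt_of_le_of_lt hst hx
  calc ∫⁻ t in Set.Ioi 0, surfaceMeasure Ω η {x | t ≤ ψ x}
      ≤ ∫⁻ t in Set.Ioi (0 : ℝ), c₁ * ENNReal.ofReal (layerConst N) *
        liminf (fun ε => ENNReal.ofReal (1 / ε) *
          (volume.restrict (layer Ω η ε)) {x | t < 2 * ψ x}) (𝓝[>] 0) :=
        setLIntegral_mono_ae' measurableSet_Ioi (Eventually.of_forall fun t ht => hslice t ht)
    _ = c₁ * ENNReal.ofReal (layerConst N) * ∫⁻ t in Set.Ioi (0 : ℝ),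
        liminf (fun ε => ENNReal.ofReal (1 / ε) *
          (volume.restrict (layer Ω η ε)) {x | t < 2 * ψ x}) (𝓝[>] 0) :=
        lintegral_const_mul' _ _ (ENNReal.mul_ne_top ENNReal.coe_ne_top ENNReal.ofReal_ne_top)
    _ ≤ c₁ * ENNReal.ofReal (layerConst N) * liminf (fun ε => ∫⁻ t in Set.Ioi (0 : ℝ),
          ENNReal.ofReal (1 / ε) *
          (volume.restrict (layer Ω η ε)) {x | t < 2 * ψ x}) (𝓝[>] 0) := by
        gcongr
        exact lintegral_liminf_le hmeas
    _ = c₁ * ENNReal.ofReal (layerConst N) * liminf (fun ε => 2 * (ENNReal.ofReal (1 / ε) *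
          ∫⁻ x in layer Ω η ε, ENNReal.ofReal (ψ x))) (𝓝[>] 0) := by
        congr 2
        funext ε
        rw [lintegral_const_mul' _ _ ENNReal.ofReal_ne_top, ← lintegral_eq_lintegral_meas_lt _
          (Eventually.of_forall fun x => mul_nonneg two_pos.le (h0 x))
          (continuous_const.mul hψc).measurable.aemeasurable]
        simp_rw [ENNReal.ofReal_mul two_pos.le, ENNReal.ofReal_ofNat]
        rw [lintegral_const_mul' _ _ (by simp)]
        ring
    _ = _ := by
        rw [ENNReal.liminf_const_mul_of_ne_top (by simp), ← mul_assoc, surfaceConst,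
          ENNReal.ofReal_mul (by have := (layerConst_pos N).le; positivity),
          ENNReal.ofReal_mul two_pos.le, ENNReal.ofReal_ofNat, ENNReal.ofReal_coe_nnreal]
        congr 1
        ring

end Surface

/-! ### The one-dimensional profile and the cutoff -/

section Profile

lemma one_sub_mul_sq_le_rpow_mul {a s : ℝ} (ha : 0 ≤ a) (hs : 0 ≤ s) (hs1 : s ≤ 1) :
    1 - (1 + a ^ 2) * s ^ 2 ≤ (1 - s) ^ a * (1 + a * s) := by
  have has : 0 ≤ a * s := mul_nonneg ha hs
  rcases le_total 1 a with h | h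
  · have h1 : 1 + a * -s ≤ (1 + -s) ^ a := one_add_mul_self_le_rpow_one_add (by linarith) h
    rw [← sub_eq_add_neg] at h1
    nlinarith [mul_le_mul_of_nonneg_right h1 (by linarith : 0 ≤ 1 + a * s), sq_nonneg s]
  · have h1 : (1 + s) ^ a ≤ 1 + a * s := rpow_one_add_le_one_add_mul_self (by linarith) ha h
    have h2 : (1 - s ^ 2) ≤ (1 - s ^ 2) ^ a := by
      have := Real.rpow_le_rpow_of_exponent_ge' (x := 1 - s ^ 2) (by nlinarith) (by nlinarith) ha h
      rwa [Real.rpow_one] at this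
    calc 1 - (1 + a ^ 2) * s ^ 2 ≤ 1 - s ^ 2 := by nlinarith [sq_nonneg (a * s)]
      _ ≤ (1 - s) ^ a * (1 + s) ^ a := by
        rw [← Real.mul_rpow (by linarith) (by linarith)]
        convert h2 using 2; ring
      _ ≤ _ := by
        have : 0 ≤ (1 - s) ^ a := Real.rpow_nonneg (by linarith) _
        gcongr

lemma tendsto_A₁ {R : ℝ} (hR : 0 < R) : Tendsto (A₁ R) (𝓝[>] 0) atTop := by
  refine Real.tendsto_log_atTop.comp ?_
  exact (tendsto_inv_nhdsGT_zero.const_mul_atTop hR).congr fun t => (div_eq_mul_inv R t).symm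

lemma tendsto_mul_A₁_sq {R : ℝ} (hR : 0 < R) :
    Tendsto (fun t => t * A₁ R t ^ 2) (𝓝[>] 0) (𝓝 0) := by
  have h1 : Tendsto (fun t : ℝ => Real.log R * t ^ (1 / 2 : ℝ)) (𝓝[>] 0) (𝓝 0) := by
    have : Tendsto (fun t : ℝ => Real.log R * t ^ (1 / 2 : ℝ)) (𝓝 0)
        (𝓝 (Real.log R * 0 ^ (1 / 2 : ℝ))) :=
      ((Real.continuous_rpow_const (by norm_num)).tendsto 0).const_mul _
    rw [Real.zero_rpow (by norm_num), mul_zero] at this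
    exact this.mono_left nhdsWithin_le_nhds
  have h2 := tendsto_log_mul_rpow_nhdsGT_zero (r := 1 / 2) (by norm_num)
  have h3 := (h1.sub h2).pow 2
  rw [sub_zero, zero_pow two_ne_zero] at h3
  refine h3.congr' ?_
  filter_upwards [self_mem_nhdsWithin] with t (ht : 0 < t)
  rw [A₁, Real.log_div hR.ne' ht.ne', ← sub_mul, mul_pow, ← Real.rpow_natCast (t ^ (1 / 2 : ℝ)),
    ← Real.rpow_mul ht.le]
  norm_num
  ring

lemma hasDerivAt_A₁ {R t : ℝ} (hR : 0 < R) (ht : 0 < t) : HasDerivAt (A₁ R) (-t⁻¹) t := by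
  have h1 : HasDerivAt (fun s : ℝ => R / s) (-R / t ^ 2) t := by
    simpa using (hasDerivAt_const t R).fun_div (hasDerivAt_id t) ht.ne'
  have h2 := h1.log (div_pos hR ht).ne'
  refine HasDerivAt.congr_deriv (f := A₁ R) h2 ?_
  field_simp

/-- The factor `q = β (1 - c / A₁)`: the logarithmic derivative of the positive supersolution is
`q(t) / t`. -/
noncomputable def slope₁ (β c R t : ℝ) : ℝ := β * (1 - c / A₁ R t)

/-- The profile `h = q ^ (p - 1) t ^ (-pβ)` of the vector field `h(δ) ∇δ`. -/
noncomputable def profile (p β c R t : ℝ) : ℝ := slope₁ β c R t ^ (p - 1) * t ^ (-(p * β))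

variable {p β c R t : ℝ}

lemma hasDerivAt_profile (hβ : 0 < β) (hR : 0 < R) (ht : 0 < t) (hA : 0 < A₁ R t)
    (hc : c / A₁ R t < 1) :
    HasDerivAt (profile p β c R) (-(t ^ (-(p * β) - 1) * (p * β * slope₁ β c R t ^ (p - 1)
      + (p - 1) * slope₁ β c R t ^ (p - 2) * (β * (c / A₁ R t ^ 2))))) t := by
  have hq : 0 < slope₁ β c R t := mul_pos hβ (by linarith)
  have h1 : HasDerivAt (slope₁ β c R) (-(β * (c / A₁ R t ^ 2)) * t⁻¹) t := by
    have h := (((hasDerivAt_const t c).fun_div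
      (hasDerivAt_A₁ hR ht) hA.ne').const_sub 1).const_mul β
    refine HasDerivAt.congr_deriv (f := slope₁ β c R) h ?_
    field_simp
    ring
  have h2 := h1.rpow_const (p := p - 1) (Or.inl hq.ne')
  have h3 := Real.hasDerivAt_rpow_const (x := t) (p := -(p * β)) (Or.inl ht.ne')
  have h4 := h2.fun_mul h3
  refine HasDerivAt.congr_deriv (f := profile p β c R) h4 ?_
  rw [show p - 1 - 1 = p - 2 by ring, show (t : ℝ) ^ (-(p * β)) = t ^ (-(p * β) - 1) * t by
    rw [← Real.rpow_add_one ht.ne']; ring_nf]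
  field_simp
  ring

lemma contDiffAt_profile (hβ : 0 < β) (hR : 0 < R) (ht : 0 < t) (hA : 0 < A₁ R t)
    (hc : c / A₁ R t < 1) : ContDiffAt ℝ 1 (profile p β c R) t := by
  have hq : slope₁ β c R t ≠ 0 := (mul_pos hβ (by linarith)).ne'
  have hAc : ContDiffAt ℝ 1 (A₁ R) t :=
    ContDiffAt.log (contDiffAt_const.div contDiffAt_id ht.ne') (div_pos hR ht).ne'
  have hs : ContDiffAt ℝ 1 (slope₁ β c R) t :=
    contDiffAt_const.mul (contDiffAt_const.sub (contDiffAt_const.div hAc hA.ne'))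
  exact (hs.rpow_const_of_ne hq).mul (contDiffAt_id.rpow_const_of_ne ht.ne')

/-- The differential inequality behind the improved Hardy inequality. At `q = β` the function
`pβ q ^ (p - 1) - (p - 1) q ^ p` has its maximum `β ^ p`; moving to `q = β (1 - c / A₁)` costs
`O(c² / A₁²)`, while the derivative of `c / A₁` gains a multiple of `c / A₁²`. For small `c` the
gain wins, and for small `t` it also absorbs the curvature term `K t`. -/
lemma exists_profile_supersolution (hp : 1 < p) (hβ : 0 < β) :
    ∃ c > 0, ∃ C₂ > 0, ∀ R > 0, ∀ K ≥ 0, ∃ η₁ > 0, ∀ t, 0 < t → t < η₁ →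
      1 ≤ A₁ R t ∧ c / A₁ R t ≤ 1 / 2 ∧
      (β ^ p + C₂ / A₁ R t ^ 2 + (p - 1) * slope₁ β c R t ^ p) * t ^ (-(p * β) - 1)
        ≤ -deriv (profile p β c R) t - K * profile p β c R t := by
  set μ : ℝ := (1 / 2) ^ (p - 1) with hμ
  have hμ0 : 0 < μ := by positivity
  set K₁ : ℝ := 1 + (p - 1) ^ 2
  have hK₁ : 0 < K₁ := by positivity
  have hp1 : 0 < p - 1 := by linarith
  set c : ℝ := (p - 1) * μ / (2 * K₁ * β) with hc
  have hc0 : 0 < c := by positivity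
  refine ⟨c, hc0, β ^ (p - 1) * ((p - 1) * μ * c / 4), by positivity, fun R hR K hK => ?_⟩
  have e1 : ∀ᶠ t in 𝓝[>] (0 : ℝ), max 1 (2 * c) ≤ A₁ R t :=
    (tendsto_A₁ hR).eventually_ge_atTop _
  have e2 : ∀ᶠ t in 𝓝[>] (0 : ℝ), K * (t * A₁ R t ^ 2) < (p - 1) * μ * c / 4 := by
    have := (tendsto_mul_A₁_sq hR).const_mul K
    rw [mul_zero] at this
    exact this.eventually_lt_const (by positivity)
  obtain ⟨η₁, hη₁, hη⟩ := (mem_nhdsGT_iff_exists_Ioo_subset).1 (e1.and e2)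
  refine ⟨η₁, hη₁, fun t ht htη => ?_⟩
  obtain ⟨h1, h2⟩ := hη ⟨ht, htη⟩
  have hA1 : 1 ≤ A₁ R t := (le_max_left _ _).trans h1
  have hA0 : 0 < A₁ R t := by linarith
  have hs2 : c / A₁ R t ≤ 1 / 2 := by
    rw [div_le_iff₀ hA0]
    linarith [(le_max_right 1 (2 * c)).trans h1]
  refine ⟨hA1, hs2, ?_⟩
  rw [(hasDerivAt_profile hβ hR ht hA0 (by linarith)).deriv, profile,
    show (t : ℝ) ^ (-(p * β)) = t ^ (-(p * β) - 1) * t by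
      rw [← Real.rpow_add_one ht.ne']; ring_nf]
  set A := A₁ R t
  set s := c / A with hs
  have hs0 : 0 < s := by positivity
  set T := t ^ (-(p * β) - 1)
  have hT : 0 < T := Real.rpow_pos_of_pos ht _
  have hm : 0 < 1 - s := by linarith
  -- all powers are expressed through `B = β ^ (p - 1)` and `M = (1 - s) ^ (p - 1)`
  have q1 : slope₁ β c R t ^ (p - 1) = β ^ (p - 1) * (1 - s) ^ (p - 1) :=
    Real.mul_rpow hβ.le hm.le
  have q2 : slope₁ β c R t ^ p = β ^ (p - 1) * β * ((1 - s) ^ (p - 1) * (1 - s)) := by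
    rw [← Real.rpow_add_one hβ.ne', ← Real.rpow_add_one hm.ne', sub_add_cancel]
    exact Real.mul_rpow hβ.le hm.le
  have q3 : slope₁ β c R t ^ (p - 2) * β = β ^ (p - 1) * (1 - s) ^ (p - 2) := by
    rw [show slope₁ β c R t ^ (p - 2) = β ^ (p - 2) * (1 - s) ^ (p - 2) from
      Real.mul_rpow hβ.le hm.le, show p - 1 = p - 2 + 1 by ring, Real.rpow_add_one hβ.ne']
    ring
  have q4 : β ^ p = β ^ (p - 1) * β := by rw [← Real.rpow_add_one hβ.ne', sub_add_cancel]
  have hBern := one_sub_mul_sq_le_rpow_mul hp1.le hs0.le (by linarith : s ≤ 1)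
  have hM1 : (1 - s) ^ (p - 1) ≤ 1 := Real.rpow_le_one hm.le (by linarith) hp1.le
  have hM2 : μ ≤ (1 - s) ^ (p - 1) := Real.rpow_le_rpow (by norm_num) (by linarith) hp1.le
  have hM3 : (1 - s) ^ (p - 1) ≤ (1 - s) ^ (p - 2) :=
    Real.rpow_le_rpow_of_exponent_ge hm (by linarith) (by linarith)
  set B := β ^ (p - 1)
  have hB : 0 < B := Real.rpow_pos_of_pos hβ _
  set M := (1 - s) ^ (p - 1)
  set M' := (1 - s) ^ (p - 2)
  have hKt : K * t ≤ (p - 1) * μ * c / 4 / A ^ 2 := by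
    rw [le_div_iff₀ (by positivity)]; linarith
  have hquad : K₁ * s ^ 2 * β = (p - 1) * μ * c / 2 / A ^ 2 := by
    rw [hs, hc]; field_simp
  have hfirst : (p - 1) * μ * (c / A ^ 2) ≤ (p - 1) * M' * (c / A ^ 2) := by
    have := hM2.trans hM3
    gcongr
  have hKM : K * t * M ≤ K * t := mul_le_of_le_one_right (by positivity) hM1
  have hsplit : (p - 1) * μ * (c / A ^ 2) = 4 * ((p - 1) * μ * c / 4 / A ^ 2) := by ring
  have hhalf : (p - 1) * μ * c / 2 / A ^ 2 = 2 * ((p - 1) * μ * c / 4 / A ^ 2) := by ring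
  have hcore : β + (p - 1) * μ * c / 4 / A ^ 2 + (p - 1) * (β * (M * (1 - s)))
      ≤ p * β * M + (p - 1) * M' * (c / A ^ 2) - K * t * M := by
    nlinarith [mul_le_mul_of_nonneg_left hBern hβ.le]
  rw [q1, q2, q4]
  calc _ = (T * B) * (β + (p - 1) * μ * c / 4 / A ^ 2 + (p - 1) * (β * (M * (1 - s)))) := by ring
    _ ≤ (T * B) * (p * β * M + (p - 1) * M' * (c / A ^ 2) - K * t * M) := by gcongr
    _ = T * (p * β * (B * M) + (p - 1) * (B * M') * (c / A ^ 2)) - K * (B * M * (T * t)) := by ring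
    _ = _ := by rw [← q3]; ring

lemma le_profile (hp : 1 < p) (hβ : 0 < β) {η : ℝ} (ht : 0 < t) (htη : t ≤ η)
    (hc : c / A₁ R t ≤ 1 / 2) : (β / 2) ^ (p - 1) * η ^ (-(p * β)) ≤ profile p β c R t := by
  have h1 : β / 2 ≤ slope₁ β c R t := by
    unfold slope₁; nlinarith
  exact mul_le_mul (Real.rpow_le_rpow (by positivity) h1 (by linarith))
    (Real.rpow_le_rpow_of_nonpos ht htη (by nlinarith [mul_pos (by linarith : 0 < p) hβ]))
    (Real.rpow_nonneg (by linarith) _) (Real.rpow_nonneg ((by positivity : 0 ≤ β / 2).trans h1) _)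

end Profile

section Cutoff

lemma hasDerivAt_mul_abs (s : ℝ) : HasDerivAt (fun s : ℝ => s * |s|) (2 * |s|) s := by
  rcases lt_trichotomy s 0 with h | rfl | h
  · have := (hasDerivAt_id s).fun_mul (hasDerivAt_abs_neg h)
    refine this.congr_deriv ?_
    simp [abs_of_neg h]; ring
  · rw [hasDerivAt_iff_tendsto_slope_zero]
    have : Tendsto (fun t : ℝ => |t|) (𝓝[≠] 0) (𝓝 |0|) :=
      (continuous_abs.tendsto 0).mono_left nhdsWithin_le_nhds
    simp only [abs_zero, mul_zero] at this ⊢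
    refine this.congr' ?_
    filter_upwards [self_mem_nhdsWithin] with t (ht : t ≠ 0)
    simp [ht]
  · have := (hasDerivAt_id s).fun_mul (hasDerivAt_abs_pos h)
    refine this.congr_deriv ?_
    simp [abs_of_pos h]; ring

/-- The tent function, of height `1`, supported in `[-1, 1]`. -/
noncomputable def tent (s : ℝ) : ℝ := (|s + 1| + |s - 1| - 2 * |s|) / 2

/-- The `C¹` step from `1` on `(-∞, -1]` to `0` on `[1, ∞)` with derivative `-tent`, as a
combination of translates of the antiderivative `s |s|` of `2 |s|`. -/
noncomputable def step (s : ℝ) : ℝ :=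
  1 / 2 - ((s + 1) * |s + 1| + (s - 1) * |s - 1| - 2 * (s * |s|)) / 4

lemma hasDerivAt_step (s : ℝ) : HasDerivAt step (-tent s) s := by
  have h1 := (hasDerivAt_mul_abs (s + 1)).comp_add_const s 1
  have h2 := (hasDerivAt_mul_abs (s - 1)).comp_sub_const s 1
  have h3 := ((((h1.add h2).sub
    ((hasDerivAt_mul_abs s).const_mul 2)).div_const 4).const_sub (1 / 2))
  refine HasDerivAt.congr_deriv (f := step) h3 ?_
  unfold tent; ring

lemma continuous_tent : Continuous tent := by unfold tent; fun_prop

lemma contDiff_step : ContDiff ℝ 1 step := by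
  rw [contDiff_one_iff_deriv]
  refine ⟨fun s => (hasDerivAt_step s).differentiableAt, ?_⟩
  rw [funext fun s => (hasDerivAt_step s).deriv]
  exact continuous_tent.neg

lemma tent_nonneg (s : ℝ) : 0 ≤ tent s := by
  have := abs_add_le (s + 1) (s - 1)
  rw [show s + 1 + (s - 1) = 2 * s by ring, abs_mul, abs_two] at this
  unfold tent; linarith

lemma half_le_tent {s : ℝ} (hs : |s| ≤ 1 / 2) : 1 / 2 ≤ tent s := by
  have h1 := le_abs_self (s + 1)
  have h2 := neg_le_abs (s - 1)
  unfold tent; linarith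

lemma antitone_step : Antitone step :=
  antitone_of_deriv_nonpos (fun s => (hasDerivAt_step s).differentiableAt) fun s => by
    rw [(hasDerivAt_step s).deriv]; linarith [tent_nonneg s]

lemma step_eq_zero {s : ℝ} (hs : 1 ≤ s) : step s = 0 := by
  rw [step, abs_of_nonneg (by linarith), abs_of_nonneg (by linarith), abs_of_nonneg (by linarith)]
  ring

lemma step_eq_one {s : ℝ} (hs : s ≤ -1) : step s = 1 := by
  rw [step, abs_of_nonpos (by linarith), abs_of_nonpos (by linarith), abs_of_nonpos (by linarith)]
  ring

lemma step_nonneg (s : ℝ) : 0 ≤ step s := by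
  rw [← step_eq_zero (le_max_right s 1)]
  exact antitone_step (le_max_left _ _)

lemma step_le_one (s : ℝ) : step s ≤ 1 := by
  rw [← step_eq_one (min_le_right s (-1))]
  exact antitone_step (min_le_left _ _)

/-- The cutoff `χ(t)`, equal to `1` for `t ≤ η - 2ε` and to `0` for `t ≥ η`. -/
noncomputable def cutoff (η ε t : ℝ) : ℝ := step ((t - (η - ε)) / ε)

lemma hasDerivAt_cutoff (η ε t : ℝ) :
    HasDerivAt (cutoff η ε) (-(tent ((t - (η - ε)) / ε) / ε)) t := by
  have h1 : HasDerivAt (fun t : ℝ => (t - (η - ε)) / ε) (1 / ε) t :=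
    ((hasDerivAt_id t).sub_const _).div_const ε
  have h2 := (hasDerivAt_step ((t - (η - ε)) / ε)).comp t h1
  exact h2.congr_deriv (by ring)

lemma contDiff_cutoff (η ε : ℝ) : ContDiff ℝ 1 (cutoff η ε) :=
  contDiff_step.comp (by fun_prop)

lemma cutoff_eq_zero {η ε t : ℝ} (hε : 0 < ε) (ht : η ≤ t) : cutoff η ε t = 0 :=
  step_eq_zero ((one_le_div hε).2 (by linarith))

lemma cutoff_eq_one {η ε t : ℝ} (hε : 0 < ε) (ht : t ≤ η - 2 * ε) : cutoff η ε t = 1 :=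
  step_eq_one ((div_le_iff₀ hε).2 (by linarith))

end Cutoff

/-! ### The inequality for test functions -/

section TestFunctions

lemma liminf_add_liminf_le {ι : Type*} {l : Filter ι} [l.NeBot] {u v : ι → ℝ≥0∞} {M : ℝ≥0∞}
    (h : ∀ᶠ i in l, u i + v i ≤ M) : liminf u l + liminf v l ≤ M := by
  rw [liminf_eq_iSup_iInf, liminf_eq_iSup_iInf]
  refine ENNReal.biSup_add_biSup_le' (p := fun s => s ∈ l) (q := fun s => s ∈ l)
    ⟨_, univ_mem⟩ ⟨_, univ_mem⟩ fun s hs t ht => ?_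
  obtain ⟨i, hi, his, hit⟩ := (h.and (show ∀ᶠ i in l, i ∈ s ∩ t from inter_mem hs ht)).exists
  exact (add_le_add (iInf₂_le i his) (iInf₂_le i hit)).trans hi

lemma young_rpow {p a b : ℝ} (hp : 1 < p) (ha : 0 ≤ a) (hb : 0 ≤ b) :
    p * a * b ^ (p - 1) ≤ a ^ p + (p - 1) * b ^ p := by
  have hp1 : 0 < p - 1 := by linarith
  have h := Real.young_inequality_of_nonneg ha (Real.rpow_nonneg hb (p - 1))
    (Real.HolderConjugate.conjExponent hp)
  rw [Real.conjExponent, ← Real.rpow_mul hb, mul_div_cancel₀ _ hp1.ne'] at h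
  calc p * a * b ^ (p - 1) = p * (a * b ^ (p - 1)) := by ring
    _ ≤ p * (a ^ p / p + b ^ p / (p / (p - 1))) := by gcongr
    _ = a ^ p + (p - 1) * b ^ p := by field_simp

variable {N : ℕ} {Ω : Set (EuclideanSpace ℝ (Fin N))}

lemma continuous_mul_comp_bdist (hΩ : IsOpen Ω) (hne : (frontier Ω).Nonempty)
    {ψ : EuclideanSpace ℝ (Fin N) → ℝ} (hψ : Continuous ψ) (hsub : tsupport ψ ⊆ Ω)
    {F : ℝ → ℝ} (hF : ContinuousOn F (Set.Ioi 0)) : Continuous fun x => ψ x * F (bdist Ω x) := by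
  refine continuous_of_tsupport fun x hx => ?_
  have hxΩ : x ∈ Ω := hsub (tsupport_mul_subset_left hx)
  exact hψ.continuousAt.mul ((hF.continuousAt (Ioi_mem_nhds (bdist_pos hΩ hne hxΩ))).comp
    (f := bdist Ω) (continuous_bdist Ω).continuousAt)

lemma measurableSet_tube (hΩ : IsOpen Ω) (η : ℝ) : MeasurableSet (tube Ω η) :=
  hΩ.measurableSet.inter ((isOpen_lt (continuous_bdist Ω) continuous_const).measurableSet)

lemma measurable_bdist : Measurable (bdist Ω) := (continuous_bdist Ω).measurable

lemma measurable_A₁ (R : ℝ) : Measurable (A₁ R) :=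
  Real.measurable_log.comp (measurable_const.div measurable_id)

variable {φ : EuclideanSpace ℝ (Fin N) → ℝ} {p : ℝ}

lemma continuous_norm_fderiv_rpow_mul (hΩ : IsOpen Ω) (hne : (frontier Ω).Nonempty)
    (hp : 0 < p) (hφ : IsTestFunction Ω φ) (γ : ℝ) :
    Continuous fun x => ‖fderiv ℝ φ x‖ ^ p * bdist Ω x ^ γ := by
  refine continuous_mul_comp_bdist hΩ hne (F := fun t => t ^ γ) ?_ ?_ ?_
  · exact (hφ.contDiff.continuous_fderiv (by simp)).norm.rpow_const fun _ => Or.inr hp.le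
  · refine (closure_mono fun x hx => ?_).trans
      ((tsupport_fderiv_subset ℝ (f := φ)).trans hφ.tsupport_subset)
    intro h
    simp [h, Real.zero_rpow hp.ne'] at hx
  · exact continuousOn_id.rpow_const fun t ht => Or.inl ht.ne'

lemma hasCompactSupport_norm_fderiv_rpow_mul (hp : 0 < p) (hφ : IsTestFunction Ω φ) (γ : ℝ) :
    HasCompactSupport fun x => ‖fderiv ℝ φ x‖ ^ p * bdist Ω x ^ γ := by
  refine HasCompactSupport.mul_right ?_
  exact (hφ.hasCompactSupport.fderiv ℝ).comp_left (g := fun v => ‖v‖ ^ p)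
    (by simp [Real.zero_rpow hp.ne'])

lemma integrable_norm_fderiv_rpow_mul (hΩ : IsOpen Ω) (hne : (frontier Ω).Nonempty)
    (hp : 0 < p) (hφ : IsTestFunction Ω φ) (γ : ℝ) :
    Integrable fun x => ‖fderiv ℝ φ x‖ ^ p * bdist Ω x ^ γ :=
  (continuous_norm_fderiv_rpow_mul hΩ hne hp hφ γ).integrable_of_hasCompactSupport
    (hasCompactSupport_norm_fderiv_rpow_mul hp hφ γ)

lemma contDiff_abs_rpow (hp : 1 < p) (hφ : IsTestFunction Ω φ) :
    ContDiff ℝ 1 fun x => |φ x| ^ p :=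
  (contDiff_norm_rpow (E := ℝ) hp).comp (hφ.contDiff.of_le (by simp))

lemma tsupport_abs_rpow_subset (hp : 1 < p) : tsupport (fun x => |φ x| ^ p) ⊆ tsupport φ :=
  closure_mono fun x hx h => hx (by simp [h, Real.zero_rpow (by linarith : p ≠ 0)])

lemma hasCompactSupport_abs_rpow (hp : 1 < p) (hφ : IsTestFunction Ω φ) :
    HasCompactSupport fun x => |φ x| ^ p :=
  hφ.hasCompactSupport.of_isClosed_subset (isClosed_tsupport _) (tsupport_abs_rpow_subset hp)

lemma norm_fderiv_abs_rpow (hp : 1 < p) (hφ : IsTestFunction Ω φ)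
    (x : EuclideanSpace ℝ (Fin N)) :
    ‖fderiv ℝ (fun x => |φ x| ^ p) x‖ = p * |φ x| ^ (p - 1) * ‖fderiv ℝ φ x‖ := by
  have h1 := (hasDerivAt_abs_rpow (φ x) hp).comp_hasFDerivAt x
    (hφ.contDiff.differentiable (by simp) x).hasFDerivAt
  rw [show (fun x => |φ x| ^ p) = (fun t : ℝ => |t| ^ p) ∘ φ from rfl, h1.fderiv, norm_smul,
    norm_mul, norm_mul, Real.norm_of_nonneg (by linarith : 0 ≤ p),
    Real.norm_of_nonneg (by positivity : 0 ≤ |φ x| ^ (p - 2)), Real.norm_eq_abs]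
  by_cases h : φ x = 0
  · simp [h, Real.zero_rpow (by linarith : p - 1 ≠ 0)]
  · rw [mul_assoc p, ← Real.rpow_add_one (abs_ne_zero.2 h)]
    ring_nf

lemma abs_div_rpow_mul {α β t y : ℝ} (hαβ : α * p = p - 1 - p * β) (ht : 0 < t) :
    |y / t| ^ p * t ^ (α * p) = |y| ^ p * t ^ (-(p * β) - 1) := by
  rw [abs_div, abs_of_pos ht, Real.div_rpow (abs_nonneg y) ht.le, div_mul_eq_mul_div,
    mul_div_assoc, ← Real.rpow_sub ht, hαβ]
  ring_nf

/-- `p |φ|^{p-1} |∇φ| h(t) ≤ (|∇φ|^p + (p - 1) (q |φ| / t)^p) t^{αp}`. -/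
lemma young_profile {α β c R t y a : ℝ} (hp : 1 < p) (hαβ : α * p = p - 1 - p * β) (ht : 0 < t)
    (hq : 0 ≤ slope₁ β c R t) (ha : 0 ≤ a) :
    p * |y| ^ (p - 1) * a * profile p β c R t ≤ a ^ p * t ^ (α * p)
      + (p - 1) * slope₁ β c R t ^ p * (|y| ^ p * t ^ (-(p * β) - 1)) := by
  have hb : 0 ≤ slope₁ β c R t * |y| / t := by positivity
  have h := mul_le_mul_of_nonneg_right (young_rpow hp ha hb)
    (Real.rpow_nonneg ht.le (α * p))
  rw [Real.div_rpow (by positivity) ht.le, Real.div_rpow (by positivity) ht.le,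
    Real.mul_rpow hq (abs_nonneg y), Real.mul_rpow hq (abs_nonneg y)] at h
  have e1 : t ^ (α * p) = t ^ (-(p * β)) * t ^ (p - 1) := by
    rw [← Real.rpow_add ht, hαβ]; ring_nf
  have e2 : t ^ (α * p) = t ^ (-(p * β) - 1) * t ^ p := by
    rw [← Real.rpow_add ht, hαβ]; ring_nf
  have h1 : 0 < t ^ (p - 1) := Real.rpow_pos_of_pos ht _
  have h2 : 0 < t ^ p := Real.rpow_pos_of_pos ht _
  calc _ = p * a * (slope₁ β c R t ^ (p - 1) * |y| ^ (p - 1) / t ^ (p - 1)) * t ^ (α * p) := by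
        rw [e1, profile]; field_simp
    _ ≤ _ := h
    _ = _ := by
        rw [add_mul]
        congr 1
        rw [e2]; field_simp

/-- The localization of `profile` to `(0, η)`: cut off smoothly below `d`, and by `cutoff` at
`η`. -/
noncomputable def cutProfile (p β c R d η ε t : ℝ) : ℝ :=
  Real.smoothTransition (2 * t / d - 1) * (cutoff η ε t * profile p β c R t)

section CutProfile

variable {β c R d η ε η₁ : ℝ}

lemma cutProfile_eq_zero_of_le (hd : 0 < d) {t : ℝ} (ht : t ≤ d / 2) :
    cutProfile p β c R d η ε t = 0 := by
  rw [cutProfile, Real.smoothTransition.zero_of_nonpos, zero_mul]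
  rw [sub_nonpos, div_le_one hd]; linarith

lemma cutProfile_eq_zero_of_ge (hε : 0 < ε) {t : ℝ} (ht : η ≤ t) :
    cutProfile p β c R d η ε t = 0 := by
  rw [cutProfile, cutoff_eq_zero hε ht]; ring

lemma cutProfile_of_ge (hd : 0 < d) {t : ℝ} (ht : d ≤ t) :
    cutProfile p β c R d η ε t = cutoff η ε t * profile p β c R t := by
  rw [cutProfile, Real.smoothTransition.one_of_one_le, one_mul]
  rw [le_sub_iff_add_le, le_div_iff₀ hd]; linarith

lemma contDiff_cutProfile (hβ : 0 < β) (hR : 0 < R) (hd : 0 < d) (hε : 0 < ε) (hη : η < η₁)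
    (h1 : ∀ t, 0 < t → t < η₁ → 1 ≤ A₁ R t ∧ c / A₁ R t ≤ 1 / 2) :
    ContDiff ℝ 1 (cutProfile p β c R d η ε) := by
  rw [contDiff_iff_contDiffAt]
  intro t
  rcases lt_or_ge t (d / 2) with ht | ht
  · refine (contDiffAt_const (c := (0 : ℝ))).congr_of_eventuallyEq ?_
    filter_upwards [Iio_mem_nhds ht] with s (hs : s < d / 2) using
      cutProfile_eq_zero_of_le hd hs.le
  rcases lt_or_ge η t with ht' | ht'
  · refine (contDiffAt_const (c := (0 : ℝ))).congr_of_eventuallyEq ?_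
    filter_upwards [Ioi_mem_nhds ht'] with s (hs : η < s) using
      cutProfile_eq_zero_of_ge hε hs.le
  have ht0 : 0 < t := by linarith
  obtain ⟨hA, hc⟩ := h1 t ht0 (by linarith)
  have hs : ContDiffAt ℝ 1 (fun t : ℝ => Real.smoothTransition (2 * t / d - 1)) t := by
    have : ContDiff ℝ 1 fun t : ℝ => 2 * t / d - 1 := by fun_prop
    exact ((Real.smoothTransition.contDiff (n := 1)).comp this).contDiffAt
  exact hs.mul ((contDiff_cutoff η ε).contDiffAt.mul
    (contDiffAt_profile hβ hR ht0 (by linarith) (by linarith)))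

lemma hasCompactSupport_cutProfile (hd : 0 < d) (hε : 0 < ε) :
    HasCompactSupport (cutProfile p β c R d η ε) := by
  refine HasCompactSupport.of_support_subset_isCompact (isCompact_Icc (a := 0) (b := η)) ?_
  intro t ht
  constructor
  · by_contra! h
    exact ht (cutProfile_eq_zero_of_le hd (by linarith))
  · by_contra! h
    exact ht (cutProfile_eq_zero_of_ge hε h.le)

lemma slope₁_nonneg (hβ : 0 < β) {t : ℝ} (h : c / A₁ R t ≤ 1 / 2) : 0 ≤ slope₁ β c R t :=
  mul_nonneg hβ.le (by linarith)

lemma cutProfile_nonneg (hβ : 0 < β) (hd : 0 < d) (hε : 0 < ε) (hη : η < η₁)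
    (h1 : ∀ t, 0 < t → t < η₁ → 1 ≤ A₁ R t ∧ c / A₁ R t ≤ 1 / 2) (t : ℝ) :
    0 ≤ cutProfile p β c R d η ε t := by
  rcases le_or_gt t (d / 2) with ht | ht
  · rw [cutProfile_eq_zero_of_le hd ht]
  rcases le_or_gt η t with ht' | ht'
  · rw [cutProfile_eq_zero_of_ge hε ht']
  have ht0 : 0 < t := by linarith
  exact mul_nonneg (Real.smoothTransition.nonneg _) (mul_nonneg (step_nonneg _)
    (mul_nonneg (Real.rpow_nonneg (slope₁_nonneg hβ (h1 t ht0 (by linarith)).2) _)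
      (Real.rpow_nonneg ht0.le _)))

lemma deriv_cutProfile (hβ : 0 < β) (hR : 0 < R) (hd : 0 < d)
    (h1 : ∀ t, 0 < t → t < η₁ → 1 ≤ A₁ R t ∧ c / A₁ R t ≤ 1 / 2) {t : ℝ} (ht : d < t)
    (htη : t < η₁) :
    deriv (cutProfile p β c R d η ε) t = cutoff η ε t * deriv (profile p β c R) t
      - tent ((t - (η - ε)) / ε) / ε * profile p β c R t := by
  have ht0 : 0 < t := hd.trans ht
  obtain ⟨hA, hc⟩ := h1 t ht0 htη
  have hprof : DifferentiableAt ℝ (profile p β c R) t :=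
    (hasDerivAt_profile hβ hR ht0 (by linarith) (by linarith)).differentiableAt
  have heq : cutProfile p β c R d η ε =ᶠ[𝓝 t] fun t => cutoff η ε t * profile p β c R t := by
    filter_upwards [Ioi_mem_nhds ht] with s (hs : d < s) using cutProfile_of_ge hd hs.le
  rw [heq.deriv_eq, ((hasDerivAt_cutoff η ε t).fun_mul hprof.hasDerivAt).deriv]
  ring

end CutProfile

variable {α β c C₂ R η η₁ ε r : ℝ}

/-- The Hardy inequality with the cutoff `cutoff η ε` in place of the characteristic function of the
tube and with an average over `layer Ω η ε` in place of the integral over `Σ_η`. -/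
lemma lintegral_cutoff_add_lintegral_layer_le (hΩ : IsOpen Ω) (hne : (frontier Ω).Nonempty)
    (hr : 0 < r) (hB : HasExteriorBalls Ω r) (hp : 1 < p) (hβ : 0 < β)
    (hαβ : α * p = p - 1 - p * β) (hC₂ : 0 < C₂) (hR : 0 < R)
    (hsup : ∀ t, 0 < t → t < η₁ → 1 ≤ A₁ R t ∧ c / A₁ R t ≤ 1 / 2 ∧
      (β ^ p + C₂ / A₁ R t ^ 2 + (p - 1) * slope₁ β c R t ^ p) * t ^ (-(p * β) - 1)
        ≤ -deriv (profile p β c R) t - N / r * profile p β c R t)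
    (hη : 0 < η) (hη₁ : η < η₁) (hε : 0 < ε) (hφ : IsTestFunction Ω φ) :
    (∫⁻ x in tube Ω η, ENNReal.ofReal (cutoff η ε (bdist Ω x) *
        ((β ^ p + C₂ / A₁ R (bdist Ω x) ^ 2) *
          (|φ x / bdist Ω x| ^ p * bdist Ω x ^ (α * p)))))
      + ENNReal.ofReal ((β / 2) ^ (p - 1) * η ^ (-(p * β)) / 2) *
        (ENNReal.ofReal (1 / ε) * ∫⁻ x in layer Ω η ε, ENNReal.ofReal (|φ x| ^ p))
      ≤ ∫⁻ x in tube Ω η, ENNReal.ofReal (‖fderiv ℝ φ x‖ ^ p * bdist Ω x ^ (α * p)) := by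
  obtain ⟨d', hd', hdist⟩ := hφ.hasCompactSupport.isCompact.exists_forall_le'
    (continuous_bdist Ω).continuousOn (a := 0)
    (fun x hx => bdist_pos hΩ hne (hφ.tsupport_subset hx))
  set d := d' / 2
  have hd : 0 < d := by positivity
  have hdK : ∀ x ∈ tsupport φ, d < bdist Ω x := fun x hx =>
    (half_lt_self hd').trans_le (hdist x hx)
  have hp0 : p ≠ 0 := by linarith
  have h1 : ∀ t, 0 < t → t < η₁ → 1 ≤ A₁ R t ∧ c / A₁ R t ≤ 1 / 2 := fun t h h' =>
    ⟨(hsup t h h').1, (hsup t h h').2.1⟩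
  set k := cutProfile p β c R d η ε with hk
  have hkC : ContDiff ℝ 1 k := contDiff_cutProfile hβ hR hd hε hη₁ h1
  have hkc : HasCompactSupport k := hasCompactSupport_cutProfile hd hε
  have hk0 : ∀ t, 0 ≤ k t := cutProfile_nonneg hβ hd hε hη₁ h1
  set ψ : EuclideanSpace ℝ (Fin N) → ℝ := fun x => |φ x| ^ p with hψ
  have hψC : ContDiff ℝ 1 ψ := contDiff_abs_rpow hp hφ
  have hψc : HasCompactSupport ψ := hasCompactSupport_abs_rpow hp hφ
  have hψ0 : ∀ x, 0 ≤ ψ x := fun x => by positivity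
  have hψsub : tsupport ψ ⊆ Ω := (tsupport_abs_rpow_subset hp).trans hφ.tsupport_subset
  have hmain := neg_integral_mul_deriv_le_integral_norm_fderiv_mul hΩ hne hr hB hψC hψc hψsub hψ0
    hkC hkc hk0
  set F₁ : EuclideanSpace ℝ (Fin N) → ℝ :=
    fun x => ψ x * (deriv k (bdist Ω x) + N / r * k (bdist Ω x)) with hF₁
  set F₂ : EuclideanSpace ℝ (Fin N) → ℝ := fun x => ‖fderiv ℝ ψ x‖ * k (bdist Ω x) with hF₂
  have hδc := continuous_bdist Ω
  have iF₁ : Integrable F₁ := by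
    have := hkC.continuous
    have := hkC.continuous_deriv le_rfl
    have := hψC.continuous
    exact Continuous.integrable_of_hasCompactSupport (by fun_prop) hψc.mul_right
  have iF₂ : Integrable F₂ := by
    have := hkC.continuous
    have := hψC.continuous_fderiv one_ne_zero
    exact Continuous.integrable_of_hasCompactSupport (by fun_prop) (hψc.fderiv ℝ).norm.mul_right
  have hmt := measurableSet_tube hΩ η
  have hml := measurableSet_layer (Ω := Ω) η ε
  set q : EuclideanSpace ℝ (Fin N) → ℝ := fun x => ‖fderiv ℝ φ x‖ ^ p * bdist Ω x ^ (α * p)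
  set Q := (tube Ω η).indicator q with hQ
  have iQ : Integrable Q :=
    (integrable_norm_fderiv_rpow_mul hΩ hne (by linarith) hφ _).indicator hmt
  set w : EuclideanSpace ℝ (Fin N) → ℝ := fun x => cutoff η ε (bdist Ω x) *
        ((β ^ p + C₂ / A₁ R (bdist Ω x) ^ 2) *
          (|φ x / bdist Ω x| ^ p * bdist Ω x ^ (α * p))) with hw
  set h₀ := (β / 2) ^ (p - 1) * η ^ (-(p * β)) / 2 with hh₀
  have hh₀0 : 0 ≤ h₀ := by positivity
  set P₁ := (tube Ω η).indicator w with hP₁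
  set P₂ := (layer Ω η ε).indicator (fun x => h₀ * (1 / ε) * ψ x) with hP₂
  have hwm : Measurable w := by
    have h1 := (contDiff_cutoff η ε).continuous.measurable
    have h2 := measurable_A₁ R
    have h3 := measurable_bdist (Ω := Ω)
    have h4 := hφ.contDiff.continuous.measurable
    fun_prop
  have hP₁m : Measurable P₁ := hwm.indicator hmt
  have hP₂m : Measurable P₂ := (hψC.continuous.measurable.const_mul _).indicator hml
  have hw0 : ∀ x, 0 ≤ w x := fun x => by
    have := bdist_nonneg (Ω := Ω) x
    exact mul_nonneg (step_nonneg _) (by positivity)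
  have hP₁0 : ∀ x, 0 ≤ P₁ x := Set.indicator_nonneg fun x _ => hw0 x
  have hP₂0 : ∀ x, 0 ≤ P₂ x := Set.indicator_nonneg fun x _ =>
    mul_nonneg (by positivity) (hψ0 x)
  have hq0 : ∀ x, 0 ≤ q x := fun x => by
    have := bdist_nonneg (Ω := Ω) x
    positivity
  have hpt : ∀ x, P₁ x + P₂ x ≤ Q x + (-F₁ x - F₂ x) := by
    intro x
    by_cases hx : x ∈ tsupport φ
    swap
    · have e1 : φ x = 0 := image_eq_zero_of_notMem_tsupport hx
      have e2 : ψ x = 0 := by simp [hψ, e1, Real.zero_rpow hp0]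
      have e3 : fderiv ℝ ψ x = 0 := image_eq_zero_of_notMem_tsupport fun h =>
        hx (tsupport_abs_rpow_subset hp (tsupport_fderiv_subset ℝ h))
      have e4 : w x = 0 := by simp [hw, e1, Real.zero_rpow hp0]
      have e5 : 0 ≤ Q x := Set.indicator_nonneg (fun x _ => hq0 x) x
      have e6 : P₁ x = 0 := Set.indicator_apply_eq_zero.2 fun _ => e4
      have e7 : P₂ x = 0 := Set.indicator_apply_eq_zero.2 fun _ => by rw [e2, mul_zero]
      rw [e6, e7]
      simpa [hF₁, hF₂, e2, e3] using e5
    have hdx := hdK x hx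
    have hδ0 : 0 < bdist Ω x := hd.trans hdx
    rcases le_or_gt η (bdist Ω x) with hge | hlt
    · have e1 : k (bdist Ω x) = 0 := cutProfile_eq_zero_of_ge hε hge
      have e2 : deriv k (bdist Ω x) = 0 := by
        refine IsLocalMin.deriv_eq_zero (Eventually.of_forall fun t => ?_)
        rw [e1]; exact hk0 t
      have e3 : x ∉ tube Ω η := fun h => (h.2.trans_le hge).false
      have e4 : x ∉ layer Ω η ε := fun h => by
        have h : |bdist Ω x - (η - ε)| ≤ ε / 2 := h
        linarith [(abs_le.1 h).2]
      simp [hP₁, hP₂, hF₁, hF₂, hQ, e1, e2, e3, e4]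
    · have hxt : x ∈ tube Ω η := ⟨hφ.tsupport_subset hx, hlt⟩
      obtain ⟨hA, hc, hs⟩ := hsup (bdist Ω x) hδ0 (hlt.trans hη₁)
      have hy := young_profile (a := ‖fderiv ℝ φ x‖) (y := φ x) hp hαβ hδ0 (slope₁_nonneg hβ hc)
        (norm_nonneg _)
      have hle := le_profile hp hβ hδ0 hlt.le hc
      rw [hP₁, hQ, Set.indicator_of_mem hxt, Set.indicator_of_mem hxt]
      simp only [hw, hF₁, hF₂, hk, deriv_cutProfile hβ hR hd h1 hdx (hlt.trans hη₁),
        cutProfile_of_ge hd hdx.le, hψ, norm_fderiv_abs_rpow hp hφ]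
      rw [abs_div_rpow_mul hαβ hδ0]
      have hlay : P₂ x ≤ tent ((bdist Ω x - (η - ε)) / ε) / ε * profile p β c R (bdist Ω x) *
          |φ x| ^ p := by
        have hprof : 0 ≤ profile p β c R (bdist Ω x) := le_trans (by positivity) hle
        by_cases hxl : x ∈ layer Ω η ε
        · rw [hP₂, Set.indicator_of_mem hxl]
          have ht : 1 / 2 ≤ tent ((bdist Ω x - (η - ε)) / ε) := by
            refine half_le_tent ?_
            rw [abs_div, abs_of_pos hε, div_le_iff₀ hε]
            have : |bdist Ω x - (η - ε)| ≤ ε / 2 := hxl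
            linarith
          calc h₀ * (1 / ε) * ψ x
              = (1 / 2) / ε * ((β / 2) ^ (p - 1) * η ^ (-(p * β))) * ψ x := by rw [hh₀]; ring
            _ ≤ _ := by
              have := hψ0 x
              simp only [hψ] at this ⊢
              gcongr
        · rw [hP₂, Set.indicator_of_notMem hxl]
          have := tent_nonneg ((bdist Ω x - (η - ε)) / ε)
          positivity
      have hχ0 : 0 ≤ cutoff η ε (bdist Ω x) := step_nonneg _
      have hχ1 : cutoff η ε (bdist Ω x) ≤ 1 := step_le_one _
      have hs' := mul_le_mul_of_nonneg_left hs (mul_nonneg hχ0 (hψ0 x))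
      have hy' := mul_le_mul_of_nonneg_left hy hχ0
      have hq' := mul_le_mul_of_nonneg_right hχ1 (hq0 x)
      simp only [hψ] at hs'
      simp only [q] at hq' ⊢
      linear_combination hlay + hs' + hy' + hq'
  have iG : Integrable fun x => Q x + (-F₁ x - F₂ x) := iQ.add (iF₁.neg.sub iF₂)
  have iP : Integrable fun x => P₁ x + P₂ x := by
    refine Integrable.mono' iG (hP₁m.add hP₂m).aestronglyMeasurable
      (Eventually.of_forall fun x => ?_)
    rw [Real.norm_of_nonneg (add_nonneg (hP₁0 x) (hP₂0 x))]
    exact hpt x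
  have hint : ∫ x, (P₁ x + P₂ x) ≤ ∫ x, Q x := by
    have h := integral_mono iP iG hpt
    have e : ∫ x, (Q x + (-F₁ x - F₂ x)) = (∫ x, Q x) + (-(∫ x, F₁ x) - ∫ x, F₂ x) := by
      have h1 : Integrable fun x => -F₁ x := iF₁.neg
      have h2 : Integrable fun x => -F₁ x - F₂ x := h1.sub iF₂
      rw [integral_add iQ h2, integral_sub h1 iF₂, integral_neg]
    linarith
  have hfin : ∫⁻ x, ENNReal.ofReal (P₁ x + P₂ x) ≤ ∫⁻ x, ENNReal.ofReal (Q x) := by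
    rw [← ofReal_integral_eq_lintegral_ofReal iP
      (Eventually.of_forall fun x => add_nonneg (hP₁0 x) (hP₂0 x)),
      ← ofReal_integral_eq_lintegral_ofReal iQ
      (Eventually.of_forall (Set.indicator_nonneg fun x _ => hq0 x))]
    exact ENNReal.ofReal_le_ofReal hint
  have hind : ∀ (S : Set (EuclideanSpace ℝ (Fin N))) (f : EuclideanSpace ℝ (Fin N) → ℝ),
      MeasurableSet S →
        ∫⁻ x, ENNReal.ofReal (S.indicator f x) = ∫⁻ x in S, ENNReal.ofReal (f x) := by
    intro S f hS
    rw [← lintegral_indicator hS]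
    congr 1 with x
    by_cases h : x ∈ S <;> simp [h]
  simp_rw [ENNReal.ofReal_add (hP₁0 _) (hP₂0 _)] at hfin
  rw [lintegral_add_left hP₁m.ennreal_ofReal, hind _ _ hmt, hind _ _ hmt, hind _ _ hml] at hfin
  refine le_trans (le_of_eq ?_) hfin
  congr 1
  rw [← mul_assoc, ← ENNReal.ofReal_mul hh₀0, ← lintegral_const_mul' _ _ ENNReal.ofReal_ne_top]
  refine lintegral_congr fun x => ?_
  rw [← ENNReal.ofReal_mul (by positivity)]

/-- The Hardy inequality for test functions, in terms of lower integrals: the limit `ε → 0` of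
`lintegral_cutoff_add_lintegral_layer_le`. -/
lemma lintegral_tube_add_lintegral_level_le (hN : 1 ≤ N) (hΩ : IsOpen Ω)
    (hne : (frontier Ω).Nonempty)
    (hr : 0 < r) (hB : HasExteriorBalls Ω r) (hp : 1 < p) (hβ : 0 < β)
    (hαβ : α * p = p - 1 - p * β) (hC₂ : 0 < C₂) (hR : 0 < R)
    (hsup : ∀ t, 0 < t → t < η₁ → 1 ≤ A₁ R t ∧ c / A₁ R t ≤ 1 / 2 ∧
      (β ^ p + C₂ / A₁ R t ^ 2 + (p - 1) * slope₁ β c R t ^ p) * t ^ (-(p * β) - 1)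
        ≤ -deriv (profile p β c R) t - N / r * profile p β c R t)
    (hη : 0 < η) (hη₁ : η < η₁) (hηs : η * surfaceConst N ≤ (β / 2) ^ (p - 1) / 2)
    (hφ : IsTestFunction Ω φ) :
    (∫⁻ x in tube Ω η, ENNReal.ofReal ((β ^ p + C₂ / A₁ R (bdist Ω x) ^ 2) *
          (|φ x / bdist Ω x| ^ p * bdist Ω x ^ (α * p))))
      + ENNReal.ofReal (η ^ (2 - p)) *
        ∫⁻ x, ENNReal.ofReal (|φ x| ^ p * bdist Ω x ^ (α * p)) ∂(surfaceMeasure Ω η)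
      ≤ ∫⁻ x in tube Ω η, ENNReal.ofReal (‖fderiv ℝ φ x‖ ^ p * bdist Ω x ^ (α * p)) := by
  set M := ∫⁻ x in tube Ω η, ENNReal.ofReal (‖fderiv ℝ φ x‖ ^ p * bdist Ω x ^ (α * p))
  set f : ℝ → EuclideanSpace ℝ (Fin N) → ℝ≥0∞ := fun ε x => ENNReal.ofReal
    (cutoff η ε (bdist Ω x) * ((β ^ p + C₂ / A₁ R (bdist Ω x) ^ 2) *
      (|φ x / bdist Ω x| ^ p * bdist Ω x ^ (α * p))))
  have hpos : ∀ᶠ ε : ℝ in 𝓝[>] 0, 0 < ε := self_mem_nhdsWithin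
  have hbound := liminf_add_liminf_le (l := 𝓝[>] (0 : ℝ)) (hpos.mono fun ε hε =>
    lintegral_cutoff_add_lintegral_layer_le hΩ hne hr hB hp hβ hαβ hC₂ hR hsup hη hη₁ hε hφ)
  refine le_trans (add_le_add ?_ ?_) hbound
  · have hmeas : ∀ ε, Measurable (f ε) := by
      intro ε
      have h1 := (contDiff_cutoff η ε).continuous.measurable
      have h2 := measurable_A₁ R
      have h3 := measurable_bdist (Ω := Ω)
      have h4 := hφ.contDiff.continuous.measurable
      fun_prop
    refine le_trans (setLIntegral_mono_ae' (measurableSet_tube hΩ η)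
      (Eventually.of_forall fun x hx => ?_)) (lintegral_liminf_le hmeas)
    have hlim : (fun ε => f ε x) =ᶠ[𝓝[>] 0] fun _ => ENNReal.ofReal
        ((β ^ p + C₂ / A₁ R (bdist Ω x) ^ 2) *
          (|φ x / bdist Ω x| ^ p * bdist Ω x ^ (α * p))) := by
      have hx2 : ∀ᶠ ε : ℝ in 𝓝[>] 0, ε < (η - bdist Ω x) / 2 :=
        mem_nhdsWithin_of_mem_nhds (Iio_mem_nhds (half_pos (sub_pos.2 hx.2)))
      filter_upwards [hpos, hx2] with ε hε hε2
      simp only [f]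
      rw [cutoff_eq_one hε (by linarith), one_mul]
    rw [liminf_congr hlim, liminf_const]
  · obtain ⟨A, hA⟩ := (contDiff_abs_rpow hp hφ).lipschitzWith_of_hasCompactSupport
      (hasCompactSupport_abs_rpow hp hφ) one_ne_zero
    have hsurf := lintegral_surfaceMeasure_le_liminf hN hne hη hA fun x => by positivity
    rw [ENNReal.liminf_const_mul_of_ne_top ENNReal.ofReal_ne_top]
    have hlevel : ∫⁻ x, ENNReal.ofReal (|φ x| ^ p * bdist Ω x ^ (α * p)) ∂(surfaceMeasure Ω η)
        = ENNReal.ofReal (η ^ (α * p)) *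
          ∫⁻ x, ENNReal.ofReal (|φ x| ^ p) ∂(surfaceMeasure Ω η) := by
      rw [← lintegral_const_mul' _ _ ENNReal.ofReal_ne_top]
      refine setLIntegral_congr_fun ?_ fun x hx => ?_
      · exact hΩ.measurableSet.inter
          ((isClosed_eq (continuous_bdist Ω) continuous_const).measurableSet)
      · rw [hx.2, mul_comm, ENNReal.ofReal_mul (by positivity)]
    rw [hlevel, ← mul_assoc, ← ENNReal.ofReal_mul (by positivity)]
    refine (mul_le_mul_right hsurf _).trans ?_
    rw [← mul_assoc, ← ENNReal.ofReal_mul (by positivity)]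
    gcongr
    -- `η ^ (2 - p) η ^ (αp) = η · η ^ (-pβ)`, and the spare factor `η` absorbs `surfaceConst N`
    have e : η ^ (2 - p) * η ^ (α * p) = η * η ^ (-(p * β)) := by
      rw [← Real.rpow_add hη, hαβ, show 2 - p + (p - 1 - p * β) = 1 + -(p * β) by ring,
        Real.rpow_add hη, Real.rpow_one]
    rw [e]
    have := mul_le_mul_of_nonneg_right hηs (Real.rpow_nonneg hη.le (-(p * β)))
    linarith

end TestFunctions

/-! ### Passage to the completion -/

section Completion

lemma exists_tendsto_eLpNorm_sub {X Y E F : Type*} [MeasurableSpace X] [MeasurableSpace Y]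
    [NormedAddCommGroup E] [CompleteSpace E] [NormedAddCommGroup F] {μ : Measure X} {ν : Measure Y}
    {q : ℝ≥0∞} (hq : 1 ≤ q) {f : ℕ → X → E} (hf : ∀ k, MemLp (f k) q μ) {v : ℕ → Y → F} {G : Y → F}
    (hv : ∀ k, AEStronglyMeasurable (v k) ν) (hG : AEStronglyMeasurable G ν) {C : ℝ≥0∞}
    (hC : C ≠ ⊤) (hfv : ∀ k l, eLpNorm (f k - f l) q μ ≤ C * eLpNorm (v k - v l) q ν)
    (hlim : Tendsto (fun k => eLpNorm (v k - G) q ν) atTop (𝓝 0)) :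
    ∃ g, MemLp g q μ ∧ Tendsto (fun k => eLpNorm (f k - g) q μ) atTop (𝓝 0) := by
  have : Fact (1 ≤ q) := ⟨hq⟩
  have hcauchy : CauchySeq fun k => (hf k).toLp (f k) := by
    rw [Lp.cauchySeq_Lp_iff_cauchySeq_eLpNorm]
    have h1 : Tendsto (fun n : ℕ × ℕ => C * (eLpNorm (v n.1 - G) q ν + eLpNorm (v n.2 - G) q ν))
        atTop (𝓝 0) := by
      rw [← prod_atTop_atTop_eq]
      have h2 := ENNReal.Tendsto.const_mul ((hlim.comp tendsto_fst).add (hlim.comp tendsto_snd))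
        (a := C) (Or.inr hC) (f := atTop ×ˢ atTop)
      simpa using h2
    refine tendsto_of_tendsto_of_tendsto_of_le_of_le tendsto_const_nhds h1 (fun _ => zero_le)
      fun n => ?_
    have h2 : eLpNorm (⇑((hf n.1).toLp (f n.1)) - ⇑((hf n.2).toLp (f n.2))) q μ
        = eLpNorm (f n.1 - f n.2) q μ :=
      eLpNorm_congr_ae ((hf n.1).coeFn_toLp.sub (hf n.2).coeFn_toLp)
    have h3 : eLpNorm (v n.1 - v n.2) q ν
        ≤ eLpNorm (v n.1 - G) q ν + eLpNorm (v n.2 - G) q ν := by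
      have h4 := eLpNorm_sub_le ((hv n.1).sub hG) ((hv n.2).sub hG) hq
      rwa [sub_sub_sub_cancel_right] at h4
    dsimp only
    rw [h2]
    exact (hfv _ _).trans (mul_le_mul_right h3 C)
  obtain ⟨g, hg⟩ := cauchySeq_tendsto_of_complete hcauchy
  refine ⟨g, Lp.memLp g, ?_⟩
  refine ((Lp.tendsto_Lp_iff_tendsto_eLpNorm' _ _).1 hg).congr fun k => ?_
  exact eLpNorm_congr_ae ((hf k).coeFn_toLp.sub (ae_eq_refl _))

variable {N : ℕ} {Ω : Set (EuclideanSpace ℝ (Fin N))}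

/-- The measure `δ^{αp} dx`. -/
noncomputable def weightedVolume (Ω : Set (EuclideanSpace ℝ (Fin N))) (α p : ℝ) :
    Measure (EuclideanSpace ℝ (Fin N)) :=
  volume.withDensity fun x => ENNReal.ofReal (bdist Ω x ^ (α * p))

variable {α p : ℝ}

lemma measurable_weight :
    Measurable fun x : EuclideanSpace ℝ (Fin N) => ENNReal.ofReal (bdist Ω x ^ (α * p)) :=
  (measurable_bdist.pow_const _).ennreal_ofReal

lemma setLIntegral_weightedVolume {S : Set (EuclideanSpace ℝ (Fin N))} (hS : MeasurableSet S)
    (f : EuclideanSpace ℝ (Fin N) → ℝ≥0∞) :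
    ∫⁻ x in S, f x ∂(weightedVolume Ω α p)
      = ∫⁻ x in S, f x * ENNReal.ofReal (bdist Ω x ^ (α * p)) := by
  rw [weightedVolume, setLIntegral_withDensity_eq_setLIntegral_mul_non_measurable _
    measurable_weight _ hS (Eventually.of_forall fun _ => ENNReal.ofReal_lt_top)]
  simp_rw [Pi.mul_apply, mul_comm]

lemma restrict_weightedVolume_absolutelyContinuous (S : Set (EuclideanSpace ℝ (Fin N))) :
    (weightedVolume Ω α p).restrict S ≪ volume.restrict S :=
  (withDensity_absolutelyContinuous _ _).restrict S

lemma ae_restrict_of_ae_weightedVolume (hΩ : IsOpen Ω) (hne : (frontier Ω).Nonempty)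
    {S : Set (EuclideanSpace ℝ (Fin N))} (hS : MeasurableSet S) (hSΩ : S ⊆ Ω)
    {P : EuclideanSpace ℝ (Fin N) → Prop} (h : ∀ᵐ x ∂(weightedVolume Ω α p).restrict S, P x) :
    ∀ᵐ x ∂volume.restrict S, P x := by
  rw [weightedVolume, restrict_withDensity hS, ae_withDensity_iff measurable_weight] at h
  filter_upwards [h, ae_restrict_mem hS] with x hx hxS
  refine hx ?_
  rw [ne_eq, ENNReal.ofReal_eq_zero, not_le]
  exact Real.rpow_pos_of_pos (bdist_pos hΩ hne (hSΩ hxS)) _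

section Norms

variable {F : Type*} [NormedAddCommGroup F]

lemma weightedNorm_eq_eLpNorm (hΩ : IsOpen Ω) (hp : 1 < p) (v : EuclideanSpace ℝ (Fin N) → F) :
    weightedNorm Ω α p v = eLpNorm v (ENNReal.ofReal p) ((weightedVolume Ω α p).restrict Ω) := by
  rw [eLpNorm_eq_lintegral_rpow_enorm_toReal (by simpa using by linarith) ENNReal.ofReal_ne_top,
    ENNReal.toReal_ofReal (by linarith), setLIntegral_weightedVolume hΩ.measurableSet]
  rfl

lemma eLpNorm_rpow {X : Type*} [MeasurableSpace X] (hp : 1 < p) (μ : Measure X) (v : X → F) :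
    eLpNorm v (ENNReal.ofReal p) μ ^ p = ∫⁻ x, ‖v x‖ₑ ^ p ∂μ := by
  rw [eLpNorm_eq_lintegral_rpow_enorm_toReal (by simpa using by linarith) ENNReal.ofReal_ne_top,
    ENNReal.toReal_ofReal (by linarith), ← ENNReal.rpow_mul, one_div_mul_cancel (by linarith),
    ENNReal.rpow_one]

lemma enorm_rpow_eq_ofReal (hp : 0 ≤ p) (v : F) : ‖v‖ₑ ^ p = ENNReal.ofReal (‖v‖ ^ p) := by
  rw [← ofReal_norm, ENNReal.ofReal_rpow_of_nonneg (norm_nonneg _) hp]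

lemma setLIntegral_norm_rpow_eq_eLpNorm_rpow (hp : 1 < p) {S : Set (EuclideanSpace ℝ (Fin N))}
    (hS : MeasurableSet S) (v : EuclideanSpace ℝ (Fin N) → F) :
    ∫⁻ x in S, ENNReal.ofReal (‖v x‖ ^ p * bdist Ω x ^ (α * p))
      = eLpNorm v (ENNReal.ofReal p) ((weightedVolume Ω α p).restrict S) ^ p := by
  rw [eLpNorm_rpow hp, setLIntegral_weightedVolume hS]
  refine lintegral_congr fun x => ?_
  rw [ENNReal.ofReal_mul (by positivity), enorm_rpow_eq_ofReal (by linarith)]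

end Norms

lemma norm_gradient (f : EuclideanSpace ℝ (Fin N) → ℝ) (x : EuclideanSpace ℝ (Fin N)) :
    ‖gradient f x‖ = ‖fderiv ℝ f x‖ := by
  rw [gradient, LinearIsometryEquiv.norm_map]

lemma IsTestFunction.sub {φ ψ : EuclideanSpace ℝ (Fin N) → ℝ} (hφ : IsTestFunction Ω φ)
    (hψ : IsTestFunction Ω ψ) : IsTestFunction Ω (φ - ψ) where
  contDiff := hφ.contDiff.sub hψ.contDiff
  hasCompactSupport := hφ.hasCompactSupport.sub hψ.hasCompactSupport
  tsupport_subset := (tsupport_sub φ ψ).trans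
    (Set.union_subset hφ.tsupport_subset hψ.tsupport_subset)

lemma IsTestFunction.gradient_sub {φ ψ : EuclideanSpace ℝ (Fin N) → ℝ} (hφ : IsTestFunction Ω φ)
    (hψ : IsTestFunction Ω ψ) : gradient (φ - ψ) = gradient φ - gradient ψ := by
  funext x
  rw [gradient, fderiv_sub (hφ.contDiff.differentiable (by simp) x)
    (hψ.contDiff.differentiable (by simp) x), map_sub]
  rfl

lemma IsTestFunction.continuous_gradient {φ : EuclideanSpace ℝ (Fin N) → ℝ}
    (hφ : IsTestFunction Ω φ) : Continuous (gradient φ) :=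
  (InnerProductSpace.toDual ℝ _).symm.continuous.comp (hφ.contDiff.continuous_fderiv (by simp))

lemma IsTestFunction.memLp_gradient (hΩ : IsOpen Ω) (hne : (frontier Ω).Nonempty) (hp : 1 < p)
    {φ : EuclideanSpace ℝ (Fin N) → ℝ} (hφ : IsTestFunction Ω φ) :
    MemLp (gradient φ) (ENNReal.ofReal p) ((weightedVolume Ω α p).restrict Ω) := by
  refine ⟨hφ.continuous_gradient.aestronglyMeasurable, ?_⟩
  rw [← ENNReal.rpow_lt_top_iff_of_pos (by linarith : 0 < p),
    ← setLIntegral_norm_rpow_eq_eLpNorm_rpow hp hΩ.measurableSet]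
  simp_rw [norm_gradient]
  exact ((integrable_norm_fderiv_rpow_mul hΩ hne (by linarith) hφ (α * p)).integrableOn
    (s := Ω)).lintegral_lt_top

variable {φ : ℕ → EuclideanSpace ℝ (Fin N) → ℝ} {u : EuclideanSpace ℝ (Fin N) → ℝ}
  {G : EuclideanSpace ℝ (Fin N) → EuclideanSpace ℝ (Fin N)}

lemma Approximates.tendsto_eLpNorm_gradient (hΩ : IsOpen Ω) (hp : 1 < p)
    (h : Approximates Ω α p φ u G) {S : Set (EuclideanSpace ℝ (Fin N))} (hS : S ⊆ Ω) :
    Tendsto (fun k => eLpNorm (gradient (φ k) - G) (ENNReal.ofReal p)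
      ((weightedVolume Ω α p).restrict S)) atTop (𝓝 0) := by
  refine tendsto_of_tendsto_of_tendsto_of_le_of_le tendsto_const_nhds h.tendsto
    (fun _ => zero_le) fun k => ?_
  refine (eLpNorm_mono_measure _ (Measure.restrict_mono hS le_rfl)).trans ?_
  rw [← weightedNorm_eq_eLpNorm hΩ hp]
  exact le_self_add

lemma Approximates.tendsto_eLpNorm (hΩ : IsOpen Ω) (hp : 1 < p)
    (h : Approximates Ω α p φ u G) {S : Set (EuclideanSpace ℝ (Fin N))} (hS : S ⊆ Ω) :
    Tendsto (fun k => eLpNorm (φ k - u) (ENNReal.ofReal p)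
      ((weightedVolume Ω α p).restrict S)) atTop (𝓝 0) := by
  refine tendsto_of_tendsto_of_tendsto_of_le_of_le tendsto_const_nhds h.tendsto
    (fun _ => zero_le) fun k => ?_
  refine (eLpNorm_mono_measure _ (Measure.restrict_mono hS le_rfl)).trans ?_
  rw [← weightedNorm_eq_eLpNorm hΩ hp]
  exact le_add_self

lemma Approximates.comp (h : Approximates Ω α p φ u G) {ns : ℕ → ℕ} (hns : StrictMono ns) :
    Approximates Ω α p (φ ∘ ns) u G :=
  ⟨fun k => h.isTestFunction (ns k), h.tendsto.comp hns.tendsto_atTop⟩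

lemma Approximates.memLp_grad (hΩ : IsOpen Ω) (hne : (frontier Ω).Nonempty) (hp : 1 < p)
    (h : Approximates Ω α p φ u G)
    (hG : AEStronglyMeasurable G (volume.restrict Ω)) :
    MemLp G (ENNReal.ofReal p) ((weightedVolume Ω α p).restrict Ω) := by
  have hG' := hG.mono_ac (restrict_weightedVolume_absolutelyContinuous (Ω := Ω) (α := α) (p := p) Ω)
  obtain ⟨k, hk⟩ := ((h.tendsto_eLpNorm_gradient hΩ hp le_rfl).eventually_lt_const
    ENNReal.zero_lt_top).exists
  have hφk := (h.isTestFunction k).memLp_gradient hΩ hne hp (α := α)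
  have hd : MemLp (gradient (φ k) - G) (ENNReal.ofReal p) ((weightedVolume Ω α p).restrict Ω) :=
    ⟨hφk.1.sub hG', hk⟩
  simpa using hφk.sub hd

lemma Approximates.exists_ae_tendsto (hΩ : IsOpen Ω) (hne : (frontier Ω).Nonempty) (hp : 1 < p)
    (h : Approximates Ω α p φ u G) (hu : AEStronglyMeasurable u (volume.restrict Ω))
    {S : Set (EuclideanSpace ℝ (Fin N))} (hS : MeasurableSet S) (hSΩ : S ⊆ Ω) :
    ∃ ns : ℕ → ℕ, StrictMono ns ∧
      ∀ᵐ x ∂volume.restrict S, Tendsto (fun k => φ (ns k) x) atTop (𝓝 (u x)) := by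
  have hu' := (hu.mono_ac (restrict_weightedVolume_absolutelyContinuous (Ω := Ω) (α := α) (p := p)
    Ω)).mono_measure (Measure.restrict_mono hSΩ le_rfl)
  obtain ⟨ns, hns, hae⟩ := (tendstoInMeasure_of_tendsto_eLpNorm (by simpa using by linarith)
    (fun k => (h.isTestFunction k).contDiff.continuous.aestronglyMeasurable) hu'
    (h.tendsto_eLpNorm hΩ hp hSΩ)).exists_seq_tendsto_ae
  exact ⟨ns, hns, ae_restrict_of_ae_weightedVolume hΩ hne hS hSΩ hae⟩

lemma integrableOn_norm_rpow_mul (hΩ : IsOpen Ω) (hne : (frontier Ω).Nonempty) (hp : 1 < p)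
    (hu : MemW₀ Ω α p u G) (η : ℝ) :
    IntegrableOn (fun x => ‖G x‖ ^ p * bdist Ω x ^ (α * p)) (tube Ω η) := by
  obtain ⟨φ, hφ⟩ := hu.exists_approx
  have hsub : tube Ω η ⊆ Ω := fun x hx => hx.1
  have hmem := (hφ.memLp_grad hΩ hne hp hu.aestronglyMeasurable_grad).mono_measure
    (Measure.restrict_mono hsub le_rfl)
  have hGm : AEMeasurable G (volume.restrict (tube Ω η)) :=
    (hu.aestronglyMeasurable_grad.mono_measure (Measure.restrict_mono hsub le_rfl)).aemeasurable
  have hδm := measurable_bdist (Ω := Ω)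
  have hm : AEMeasurable (fun x => ‖G x‖ ^ p * bdist Ω x ^ (α * p))
      (volume.restrict (tube Ω η)) := by fun_prop
  refine (lintegral_ofReal_ne_top_iff_integrable hm.aestronglyMeasurable
    (Eventually.of_forall fun x => ?_)).1 ?_
  · have := bdist_nonneg (Ω := Ω) x
    positivity
  · rw [setLIntegral_norm_rpow_eq_eLpNorm_rpow hp (measurableSet_tube hΩ η)]
    exact (ENNReal.rpow_lt_top_of_nonneg (by linarith) hmem.2.ne).ne

/-- The continuous extension argument: an inequality of Hardy and trace type between lower
integrals, valid for test functions, gives the existence of traces and persists in the completion.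
The left-hand side is lower semicontinuous by Fatou's lemma, the right-hand side is continuous. -/
lemma exists_isTrace_and_lintegral_le (hΩ : IsOpen Ω) (hne : (frontier Ω).Nonempty) (hp : 1 < p)
    {η ℓ : ℝ} (hη : 0 < η) (hℓ : 0 < ℓ) {W : ℝ → ℝ} (hW : Measurable W)
    (hineq : ∀ φ, IsTestFunction Ω φ →
      (∫⁻ x in tube Ω η, ENNReal.ofReal (W (bdist Ω x) *
          (|φ x / bdist Ω x| ^ p * bdist Ω x ^ (α * p))))
        + ENNReal.ofReal ℓ *
          ∫⁻ x, ENNReal.ofReal (|φ x| ^ p * bdist Ω x ^ (α * p)) ∂(surfaceMeasure Ω η)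
        ≤ ∫⁻ x in tube Ω η, ENNReal.ofReal (‖fderiv ℝ φ x‖ ^ p * bdist Ω x ^ (α * p)))
    (hu : MemW₀ Ω α p u G) :
    ∃ g, IsTrace Ω α p η u G g ∧
      (∫⁻ x in tube Ω η, ENNReal.ofReal (W (bdist Ω x) *
          (|u x / bdist Ω x| ^ p * bdist Ω x ^ (α * p))))
        + ENNReal.ofReal ℓ *
          ∫⁻ x, ENNReal.ofReal (|g x| ^ p * bdist Ω x ^ (α * p)) ∂(surfaceMeasure Ω η)
        ≤ ∫⁻ x in tube Ω η, ENNReal.ofReal (‖G x‖ ^ p * bdist Ω x ^ (α * p)) := by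
  set P := ENNReal.ofReal p with hP
  have hP1 : 1 ≤ P := by simpa [hP] using hp.le
  have hP0 : P ≠ 0 := (zero_lt_one.trans_le hP1).ne'
  have hp0 : 0 < p := by linarith
  set σ := surfaceMeasure Ω η with hσ
  have hmt := measurableSet_tube hΩ η
  have htΩ : tube Ω η ⊆ Ω := fun x hx => hx.1
  set ν := (weightedVolume Ω α p).restrict (tube Ω η) with hν
  have hνΩ : ν ≤ (weightedVolume Ω α p).restrict Ω := Measure.restrict_mono htΩ le_rfl
  have hσae : ∀ᵐ x ∂σ, bdist Ω x = η := by
    have hml : MeasurableSet (level Ω η) := hΩ.measurableSet.inter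
      ((isClosed_eq (continuous_bdist Ω) continuous_const).measurableSet)
    filter_upwards [ae_restrict_mem hml] with x hx using hx.2
  have hlevel : ∀ f : EuclideanSpace ℝ (Fin N) → ℝ,
      ∫⁻ x, ENNReal.ofReal (|f x| ^ p * bdist Ω x ^ (α * p)) ∂σ
        = ENNReal.ofReal (η ^ (α * p)) * eLpNorm f P σ ^ p := by
    intro f
    rw [eLpNorm_rpow hp, ← lintegral_const_mul' _ _ ENNReal.ofReal_ne_top]
    refine lintegral_congr_ae ?_
    filter_upwards [hσae] with x hx
    rw [hx, mul_comm, ENNReal.ofReal_mul (by positivity), enorm_rpow_eq_ofReal hp0.le,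
      Real.norm_eq_abs]
  have hineq' : ∀ φ, IsTestFunction Ω φ →
      (∫⁻ x in tube Ω η, ENNReal.ofReal (W (bdist Ω x) *
          (|φ x / bdist Ω x| ^ p * bdist Ω x ^ (α * p))))
        + ENNReal.ofReal ℓ *
          ∫⁻ x, ENNReal.ofReal (|φ x| ^ p * bdist Ω x ^ (α * p)) ∂σ
        ≤ eLpNorm (gradient φ) P ν ^ p := by
    intro φ hφ
    rw [← setLIntegral_norm_rpow_eq_eLpNorm_rpow hp hmt]
    simp_rw [norm_gradient]
    exact hineq φ hφ
  set m : ℝ≥0∞ := ENNReal.ofReal ℓ * ENNReal.ofReal (η ^ (α * p)) with hm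
  have hm0 : m ≠ 0 := by
    have := Real.rpow_pos_of_pos hη (α * p)
    rw [hm, ← ENNReal.ofReal_mul hℓ.le]
    simpa using by positivity
  have hmt' : m ≠ ⊤ := ENNReal.mul_ne_top ENNReal.ofReal_ne_top ENNReal.ofReal_ne_top
  set C := m⁻¹ ^ (1 / p) with hC
  have hCt : C ≠ ⊤ := ENNReal.rpow_ne_top_of_nonneg (by positivity) (ENNReal.inv_ne_top.2 hm0)
  have htrace : ∀ φ, IsTestFunction Ω φ → eLpNorm φ P σ ≤ C * eLpNorm (gradient φ) P ν := by
    intro φ hφ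
    have h1 := le_add_self.trans (hineq' φ hφ)
    rw [hlevel, ← mul_assoc] at h1
    have h2 : eLpNorm φ P σ ^ p ≤ m⁻¹ * eLpNorm (gradient φ) P ν ^ p := by
      rw [mul_comm, ← div_eq_mul_inv, ENNReal.le_div_iff_mul_le (Or.inl hm0) (Or.inl hmt'),
        mul_comm]
      exact h1
    have h3 := ENNReal.rpow_le_rpow h2 (by positivity : 0 ≤ 1 / p)
    rwa [ENNReal.mul_rpow_of_nonneg _ _ (by positivity), ← ENNReal.rpow_mul, ← ENNReal.rpow_mul,
      mul_one_div_cancel hp0.ne', ENNReal.rpow_one, ENNReal.rpow_one] at h3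
  have hGν : MemLp G P ν := by
    obtain ⟨φ, hφ⟩ := hu.exists_approx
    exact (hφ.memLp_grad hΩ hne hp hu.aestronglyMeasurable_grad).mono_measure hνΩ
  have hgradν : ∀ φ, IsTestFunction Ω φ → MemLp (gradient φ) P ν := fun φ hφ =>
    (hφ.memLp_gradient hΩ hne hp).mono_measure hνΩ
  have htest : ∀ φ, IsTestFunction Ω φ → MemLp φ P σ := fun φ hφ =>
    ⟨hφ.contDiff.continuous.aestronglyMeasurable,
      (htrace φ hφ).trans_lt (ENNReal.mul_lt_top hCt.lt_top (hgradν φ hφ).2)⟩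
  obtain ⟨φ, hφ⟩ := hu.exists_approx
  have hφt := hφ.isTestFunction
  obtain ⟨g, hg, hgφ⟩ := exists_tendsto_eLpNorm_sub (f := φ) (v := fun k => gradient (φ k)) hP1
    (fun k => htest _ (hφt k)) (fun k => (hgradν _ (hφt k)).1) hGν.1 hCt
    (fun k l => by
      rw [← (hφt k).gradient_sub (hφt l)]
      exact htrace _ ((hφt k).sub (hφt l)))
    (hφ.tendsto_eLpNorm_gradient hΩ hp htΩ)
  refine ⟨g, ⟨hg.1, fun φ' hφ' => ?_⟩, ?_⟩
  · -- two approximating sequences have differences tending to `0` in `L^p(Σ_η)`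
    have hφt' := hφ'.isTestFunction
    have hlim : Tendsto (fun k => eLpNorm (φ' k - g) P σ) atTop (𝓝 0) := by
      have h1 := (ENNReal.Tendsto.const_mul ((hφ'.tendsto_eLpNorm_gradient hΩ hp htΩ).add
        (hφ.tendsto_eLpNorm_gradient hΩ hp htΩ)) (a := C) (Or.inr hCt)).add hgφ
      rw [add_zero, add_zero, mul_zero] at h1
      refine tendsto_of_tendsto_of_tendsto_of_le_of_le tendsto_const_nhds h1
        (fun _ => zero_le) fun k => ?_
      have h2 : eLpNorm (φ' k - g) P σ ≤ eLpNorm (φ' k - φ k) P σ + eLpNorm (φ k - g) P σ := by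
        have := eLpNorm_add_le (((htest _ (hφt' k)).sub (htest _ (hφt k))).1)
          (((htest _ (hφt k)).sub hg).1) hP1
        rwa [sub_add_sub_cancel] at this
      refine h2.trans (add_le_add_left ((htrace _ ((hφt' k).sub (hφt k))).trans ?_) _)
      rw [(hφt' k).gradient_sub (hφt k)]
      have h4 := eLpNorm_sub_le ((hgradν _ (hφt' k)).sub hGν).1 ((hgradν _ (hφt k)).sub hGν).1 hP1
      rw [sub_sub_sub_cancel_right] at h4
      exact mul_le_mul_right h4 C
    have h3 := ((ENNReal.continuous_rpow_const (y := p)).tendsto 0).comp hlim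
    rw [ENNReal.zero_rpow_of_pos hp0] at h3
    exact h3.congr fun k => eLpNorm_rpow hp σ (φ' k - g)
  · obtain ⟨ns, hns, hae⟩ := hφ.exists_ae_tendsto hΩ hne hp hu.aestronglyMeasurable hmt htΩ
    obtain ⟨ms, hms, hae'⟩ := (tendstoInMeasure_of_tendsto_eLpNorm hP0
      (fun k => (htest _ (hφt (ns k))).1) hg.1
      (hgφ.comp hns.tendsto_atTop)).exists_seq_tendsto_ae
    set χ : ℕ → EuclideanSpace ℝ (Fin N) → ℝ := fun k => φ (ns (ms k)) with hχ
    have hχa : Approximates Ω α p χ u G := hφ.comp (hns.comp hms)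
    have hχt := hχa.isTestFunction
    have hχu : ∀ᵐ x ∂volume.restrict (tube Ω η), Tendsto (fun k => χ k x) atTop (𝓝 (u x)) :=
      hae.mono fun x hx => hx.comp hms.tendsto_atTop
    have hχg : ∀ᵐ x ∂σ, Tendsto (fun k => χ k x) atTop (𝓝 (g x)) := hae'
    have hcontp : Continuous fun t : ℝ => |t| ^ p :=
      continuous_abs.rpow_const fun _ => Or.inr hp0.le
    have hδm := measurable_bdist (Ω := Ω)
    rw [setLIntegral_norm_rpow_eq_eLpNorm_rpow hp hmt]
    have hrhs : Tendsto (fun k => (eLpNorm (gradient (χ k) - G) P ν + eLpNorm G P ν) ^ p) atTop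
        (𝓝 (eLpNorm G P ν ^ p)) := by
      have h1 := (hχa.tendsto_eLpNorm_gradient hΩ hp htΩ).add_const (eLpNorm G P ν)
      rw [zero_add] at h1
      exact ((ENNReal.continuous_rpow_const (y := p)).tendsto _).comp h1
    refine le_of_forall_gt_imp_ge_of_dense fun M hM => ?_
    have hev : ∀ᶠ k in atTop, (∫⁻ x in tube Ω η, ENNReal.ofReal (W (bdist Ω x) *
          (|χ k x / bdist Ω x| ^ p * bdist Ω x ^ (α * p))))
        + ENNReal.ofReal ℓ *
          ∫⁻ x, ENNReal.ofReal (|χ k x| ^ p * bdist Ω x ^ (α * p)) ∂σ ≤ M := by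
      filter_upwards [hrhs.eventually_lt_const hM] with k hk
      refine (hineq' _ (hχt k)).trans (le_trans (ENNReal.rpow_le_rpow ?_ hp0.le) hk.le)
      have := eLpNorm_add_le ((hgradν _ (hχt k)).sub hGν).1 hGν.1 hP1
      rwa [sub_add_cancel] at this
    refine le_trans (add_le_add ?_ ?_) (liminf_add_liminf_le hev)
    · refine le_trans (lintegral_mono_ae ?_) (lintegral_liminf_le fun k => ?_)
      · filter_upwards [hχu] with x hx
        refine le_of_eq (Tendsto.liminf_eq ?_).symm
        refine (ENNReal.continuous_ofReal.tendsto _).comp (((((hcontp.tendsto _).comp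
          (hx.div_const _))).mul_const _).const_mul _)
      · have := (hχt k).contDiff.continuous.measurable
        fun_prop
    · rw [ENNReal.liminf_const_mul_of_ne_top ENNReal.ofReal_ne_top]
      gcongr
      refine le_trans (lintegral_mono_ae ?_) (lintegral_liminf_le fun k => ?_)
      · filter_upwards [hχg] with x hx
        refine le_of_eq (Tendsto.liminf_eq ?_).symm
        exact (ENNReal.continuous_ofReal.tendsto _).comp (((hcontp.tendsto _).comp hx).mul_const _)
      · have := (hχt k).contDiff.continuous.measurable
        fun_prop

end Completion

/-! ### The Hardy inequality -/

section Integrals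

variable {N : ℕ} {Ω : Set (EuclideanSpace ℝ (Fin N))} {α p : ℝ}

/-- Translation of the inequality between lower integrals into integrability statements and an
inequality between Bochner integrals. -/
lemma integrable_and_integral_le_of_lintegral_le (hp : 1 < p) {η ℓ Λ C₂ R : ℝ}
    (hℓ : 0 < ℓ) (hΛ : 0 < Λ) (hC₂ : 0 < C₂) {u g : EuclideanSpace ℝ (Fin N) → ℝ}
    {G : EuclideanSpace ℝ (Fin N) → EuclideanSpace ℝ (Fin N)}
    (hu : AEStronglyMeasurable u (volume.restrict Ω))
    (hg : AEStronglyMeasurable g (surfaceMeasure Ω η))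
    (hG : IntegrableOn (fun x => ‖G x‖ ^ p * bdist Ω x ^ (α * p)) (tube Ω η))
    (h : (∫⁻ x in tube Ω η, ENNReal.ofReal ((Λ + C₂ / A₁ R (bdist Ω x) ^ 2) *
          (|u x / bdist Ω x| ^ p * bdist Ω x ^ (α * p))))
        + ENNReal.ofReal ℓ *
          ∫⁻ x, ENNReal.ofReal (|g x| ^ p * bdist Ω x ^ (α * p)) ∂(surfaceMeasure Ω η)
        ≤ ∫⁻ x in tube Ω η, ENNReal.ofReal (‖G x‖ ^ p * bdist Ω x ^ (α * p))) :
    IntegrableOn (fun x => |u x / bdist Ω x| ^ p * bdist Ω x ^ (α * p)) (tube Ω η) ∧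
    IntegrableOn (fun x => |u x / bdist Ω x| ^ p * (1 / A₁ R (bdist Ω x) ^ 2) *
      bdist Ω x ^ (α * p)) (tube Ω η) ∧
    Integrable (fun x => |g x| ^ p * bdist Ω x ^ (α * p)) (surfaceMeasure Ω η) ∧
    C₂ * (∫ x in tube Ω η, |u x / bdist Ω x| ^ p * (1 / A₁ R (bdist Ω x) ^ 2) *
        bdist Ω x ^ (α * p))
      + ℓ * (∫ x, |g x| ^ p * bdist Ω x ^ (α * p) ∂(surfaceMeasure Ω η))
      ≤ ∫ x in tube Ω η, (‖G x‖ ^ p - Λ * |u x / bdist Ω x| ^ p) * bdist Ω x ^ (α * p) := by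
  have hp0 : 0 ≤ p := by linarith
  have hδ0 : ∀ x, 0 ≤ bdist Ω x := bdist_nonneg
  have hδm := measurable_bdist (Ω := Ω)
  have hAm := measurable_A₁ R
  have hut : AEMeasurable u (volume.restrict (tube Ω η)) :=
    (hu.mono_measure (Measure.restrict_mono (fun x hx => hx.1) le_rfl)).aemeasurable
  have hgm := hg.aemeasurable
  set U : EuclideanSpace ℝ (Fin N) → ℝ :=
    fun x => |u x / bdist Ω x| ^ p * bdist Ω x ^ (α * p) with hU
  set V : EuclideanSpace ℝ (Fin N) → ℝ :=
    fun x => |u x / bdist Ω x| ^ p * (1 / A₁ R (bdist Ω x) ^ 2) * bdist Ω x ^ (α * p) with hV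
  set Y : EuclideanSpace ℝ (Fin N) → ℝ := fun x => |g x| ^ p * bdist Ω x ^ (α * p) with hY
  set Z : EuclideanSpace ℝ (Fin N) → ℝ := fun x => ‖G x‖ ^ p * bdist Ω x ^ (α * p) with hZ
  have hU0 : ∀ x, 0 ≤ U x := fun x => by have := hδ0 x; positivity
  have hV0 : ∀ x, 0 ≤ V x := fun x => by have := hδ0 x; positivity
  have hY0 : ∀ x, 0 ≤ Y x := fun x => by have := hδ0 x; positivity
  have hZ0 : ∀ x, 0 ≤ Z x := fun x => by have := hδ0 x; positivity
  have hUm : AEMeasurable U (volume.restrict (tube Ω η)) := by fun_prop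
  have hVm : AEMeasurable V (volume.restrict (tube Ω η)) := by fun_prop
  have hYm : AEMeasurable Y (surfaceMeasure Ω η) := by fun_prop
  have hsum : ∀ x, (Λ + C₂ / A₁ R (bdist Ω x) ^ 2) * U x = Λ * U x + C₂ * V x := fun x => by
    simp only [hU, hV]; ring
  have hZfin : ∫⁻ x in tube Ω η, ENNReal.ofReal (Z x) < ⊤ := hG.lintegral_lt_top
  have hX : ∫⁻ x in tube Ω η, ENNReal.ofReal (Λ * U x + C₂ * V x) < ⊤ := by
    simp_rw [← hsum]
    exact (le_self_add.trans h).trans_lt hZfin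
  have iX : IntegrableOn (fun x => Λ * U x + C₂ * V x) (tube Ω η) :=
    (lintegral_ofReal_ne_top_iff_integrable (by fun_prop) (Eventually.of_forall fun x => by
      have := hU0 x; have := hV0 x; positivity)).1 hX.ne
  have iU : IntegrableOn U (tube Ω η) := by
    refine (iX.const_mul Λ⁻¹).mono' hUm.aestronglyMeasurable (Eventually.of_forall fun x => ?_)
    rw [Real.norm_of_nonneg (hU0 x), le_inv_mul_iff₀ hΛ]
    have := mul_nonneg hC₂.le (hV0 x)
    linarith
  have iV : IntegrableOn V (tube Ω η) := by
    refine (iX.const_mul C₂⁻¹).mono' hVm.aestronglyMeasurable (Eventually.of_forall fun x => ?_)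
    rw [Real.norm_of_nonneg (hV0 x), le_inv_mul_iff₀ hC₂]
    have := mul_nonneg hΛ.le (hU0 x)
    linarith
  have iY : Integrable Y (surfaceMeasure Ω η) := by
    refine (lintegral_ofReal_ne_top_iff_integrable hYm.aestronglyMeasurable
      (Eventually.of_forall hY0)).1 ?_
    have h1 := (le_add_self.trans h).trans_lt hZfin
    intro h2
    rw [h2, ENNReal.mul_top (by simpa using hℓ)] at h1
    exact lt_irrefl _ h1
  refine ⟨iU, iV, iY, ?_⟩
  have e1 : ∫ x in tube Ω η, (‖G x‖ ^ p - Λ * |u x / bdist Ω x| ^ p) * bdist Ω x ^ (α * p)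
      = (∫ x in tube Ω η, Z x) - Λ * ∫ x in tube Ω η, U x := by
    rw [← integral_const_mul, ← integral_sub hG (iU.const_mul Λ)]
    congr 1 with x
    simp only [hZ, hU]; ring
  have e2 : ∫ x in tube Ω η, (Λ * U x + C₂ * V x)
      = Λ * (∫ x in tube Ω η, U x) + C₂ * ∫ x in tube Ω η, V x := by
    rw [integral_add (iU.const_mul Λ) (iV.const_mul C₂), integral_const_mul, integral_const_mul]
  have hX0 : 0 ≤ᵐ[volume.restrict (tube Ω η)] fun x => Λ * U x + C₂ * V x :=
    Eventually.of_forall fun x => by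
      have := hU0 x; have := hV0 x; positivity
  have h3 : ENNReal.ofReal ((∫ x in tube Ω η, (Λ * U x + C₂ * V x))
      + ℓ * ∫ x, Y x ∂(surfaceMeasure Ω η)) ≤ ENNReal.ofReal (∫ x in tube Ω η, Z x) := by
    rw [ENNReal.ofReal_add (integral_nonneg_of_ae hX0)
      (mul_nonneg hℓ.le (integral_nonneg hY0)), ENNReal.ofReal_mul hℓ.le,
      ofReal_integral_eq_lintegral_ofReal iX hX0,
      ofReal_integral_eq_lintegral_ofReal iY (Eventually.of_forall hY0),
      ofReal_integral_eq_lintegral_ofReal hG (Eventually.of_forall hZ0)]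
    simp_rw [← hsum]
    exact h
  rw [ENNReal.ofReal_le_ofReal_iff (integral_nonneg hZ0), e2] at h3
  rw [e1]
  linarith

end Integrals

end HardyBoundary

theorem theorem2p3 (α p R : ℝ) (hp : 1 < p) (hα : α < 1 - 1 / p) :
    ∃ C₂ L : ℝ → ℝ, (∀ η, 0 < η → 0 < C₂ η ∧ 0 < L η) ∧
      ∀ (N : ℕ), 1 ≤ N → ∀ Ω : Set (EuclideanSpace ℝ (Fin N)),
        HardyBoundary.IsBoundedC2Domain Ω →
        Real.exp 1 * sSup (HardyBoundary.bdist Ω '' Ω) < R →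
        ∃ η₀ : ℝ, 0 < η₀ ∧ ∀ η : ℝ, 0 < η → η < η₀ →
          ∀ (u : EuclideanSpace ℝ (Fin N) → ℝ)
            (G : EuclideanSpace ℝ (Fin N) → EuclideanSpace ℝ (Fin N)),
            HardyBoundary.MemW₀ Ω α p u G →
            IntegrableOn (fun x => ‖G x‖ ^ p * HardyBoundary.bdist Ω x ^ (α * p))
              (HardyBoundary.tube Ω η) ∧
            IntegrableOn (fun x => |u x / HardyBoundary.bdist Ω x| ^ p *
                HardyBoundary.bdist Ω x ^ (α * p))
              (HardyBoundary.tube Ω η) ∧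
            IntegrableOn (fun x => |u x / HardyBoundary.bdist Ω x| ^ p *
                (1 / HardyBoundary.A₁ R (HardyBoundary.bdist Ω x) ^ 2) *
                HardyBoundary.bdist Ω x ^ (α * p))
              (HardyBoundary.tube Ω η) ∧
            ∃ g : EuclideanSpace ℝ (Fin N) → ℝ,
              HardyBoundary.IsTrace Ω α p η u G g ∧
              Integrable (fun x => |g x| ^ p * HardyBoundary.bdist Ω x ^ (α * p))
                (HardyBoundary.surfaceMeasure Ω η) ∧
              C₂ η * (∫ x in HardyBoundary.tube Ω η,
                  |u x / HardyBoundary.bdist Ω x| ^ p *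
                    (1 / HardyBoundary.A₁ R (HardyBoundary.bdist Ω x) ^ 2) *
                    HardyBoundary.bdist Ω x ^ (α * p))
                + L η * (∫ x, |g x| ^ p * HardyBoundary.bdist Ω x ^ (α * p)
                    ∂(HardyBoundary.surfaceMeasure Ω η))
              ≤ ∫ x in HardyBoundary.tube Ω η,
                  (‖G x‖ ^ p - HardyBoundary.hardyConst α p *
                      |u x / HardyBoundary.bdist Ω x| ^ p) *
                    HardyBoundary.bdist Ω x ^ (α * p) := by
  set β : ℝ := 1 - 1 / p - α with hβdef
  have hβ : 0 < β := by rw [hβdef]; linarith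
  have hαβ : α * p = p - 1 - p * β := by
    rw [hβdef]; field_simp; ring
  have hΛ : HardyBoundary.hardyConst α p = β ^ p := by
    rw [HardyBoundary.hardyConst, if_neg hα.ne, abs_of_pos hβ]
  obtain ⟨c, -, C₂, hC₂, hprof⟩ := HardyBoundary.exists_profile_supersolution hp hβ
  -- The trace term is controlled with a constant `κ η ^ (1 - p)`, where `κ` depends on `N`.
  -- The choice `L η = η ^ (2 - p)` is independent of the dimension, and is smaller once `η ≤ κ`.
  refine ⟨fun _ => C₂, fun η => η ^ (2 - p), fun η hη => ⟨hC₂, Real.rpow_pos_of_pos hη _⟩, ?_⟩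
  intro N hN Ω hΩ hRΩ
  have hR : 0 < R := by
    refine lt_of_le_of_lt (mul_nonneg (Real.exp_pos 1).le (Real.sSup_nonneg ?_)) hRΩ
    rintro _ ⟨x, -, rfl⟩
    exact HardyBoundary.bdist_nonneg x
  have hne := HardyBoundary.frontier_nonempty hN hΩ
  obtain ⟨r, hr, hB⟩ := HardyBoundary.exists_hasExteriorBalls hΩ
  obtain ⟨η₁, hη₁, hsup⟩ := hprof R hR (N / r) (by positivity)
  have hs := HardyBoundary.surfaceConst_nonneg N
  refine ⟨min η₁ ((β / 2) ^ (p - 1) / 2 / (HardyBoundary.surfaceConst N + 1)), by positivity,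
    fun η hη hη₀ u G hu => ?_⟩
  have hηs : η * HardyBoundary.surfaceConst N ≤ (β / 2) ^ (p - 1) / 2 := by
    have h1 := (hη₀.trans_le (min_le_right _ _)).le
    rw [le_div_iff₀ (by positivity)] at h1
    linarith
  have hηη₁ := hη₀.trans_le (min_le_left _ _)
  obtain ⟨g, hg, hle⟩ := HardyBoundary.exists_isTrace_and_lintegral_le
    (W := fun t => β ^ p + C₂ / HardyBoundary.A₁ R t ^ 2) hΩ.isOpen hne hp hη
    (Real.rpow_pos_of_pos hη (2 - p))
    (by have := HardyBoundary.measurable_A₁ R; fun_prop)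
    (fun φ hφ => HardyBoundary.lintegral_tube_add_lintegral_level_le hN hΩ.isOpen hne hr hB hp hβ
      hαβ hC₂ hR hsup hη hηη₁ hηs hφ) hu
  have hG : IntegrableOn (fun x => ‖G x‖ ^ p * HardyBoundary.bdist Ω x ^ (α * p))
      (HardyBoundary.tube Ω η) :=
    HardyBoundary.integrableOn_norm_rpow_mul hΩ.isOpen hne hp hu η
  obtain ⟨iU, iV, iY, hfinal⟩ := HardyBoundary.integrable_and_integral_le_of_lintegral_le
    hp (Real.rpow_pos_of_pos hη (2 - p)) (Real.rpow_pos_of_pos hβ p) hC₂ hu.aestronglyMeasurable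
    hg.aestronglyMeasurable hG hle
  refine ⟨hG, iU, iV, g, hg, iY, ?_⟩
  rw [hΛ]
  exact hfinal
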